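/- Let $X$ be a connected simplicial set, $v_*$ a vertex of $X$, and $T$ a maximal tree of the $1$-skeleton of $X$ (a set of non-degenerate edges forming a spanning tree). Let $H$ be a group and $\chi:\pi_1(|X|,v_*)\to H$ a surjective homomorphism, where loops are multiplied in path order ($[\gamma][\delta]$ is first $\gamma$, then $\delta$). For an edge $e$ of $X$ let $g_e\in\pi_1(|X|,v_*)$ be the class of the loop that runs in $T$ from $v_*$ to the source $\partial_1e$, then along $e$, and then in $T$ from $\partial_0e$ back to $v_*$. Define $\tau:X\to H$ by $\tau(v)=1$ for vertices $v$, $\tau(e)=\chi(g_e)$ for edges $e$ (so $\tau(e)=1$ if $e\in T$ or $e$ is degenerate), and $\tau(\sigma)=\tau(\partial_0\sigma)$ for simplices $\sigma$ of dimension at least $2$. Let $\tilde X$ be the simplicial set with $\tilde X_n=H\times X_n$, degeneracies $\tilde s_i(h,\sigma)=(h,s_i\sigma)$, and faces $\tilde\partial_i(h,\sigma)=(h,\partial_i\sigma)$ for $i<n$ and $\tilde\partial_n(h,\sigma)=(h\,\tau(\sigma)^{-1},\partial_n\sigma)$ for $\sigma\in X_n$, $n\ge 1$. Let $\pi:\tilde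 X\to X$ be the simplicial map $(h,\sigma)\mapsto\sigma$. Then: 1. $|\tilde X|$ is path-connected, and $|\pi|:|\tilde X|\to|X|$ is a surjective covering map, namely the regular cover corresponding to $\chi$: the subgroup $|\pi|_*\bigl(\pi_1(|\tilde X|,(1,v_*))\bigr)$ of $\pi_1(|X|,v_*)$ is normal and equals $\ker\chi$. 2. If $\chi$ is an isomorphism, then $|\tilde X|$ is simply connected. Hence $|\tilde X|$ is the universal cover of $|X|$, with covering map $|\pi|$. -/

import Mathlib

universe u

namespace SimplicialCover

open CategoryTheory Opposite

noncomputable section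

/-- The set of `n`-simplices of `X`. -/
abbrev Splx (X : SSet.{u}) (n : ℕ) : Type u := X.obj (op (SimplexCategory.mk n))

/-- The characteristic map `Δⁿ → |X|` of an `n`-simplex `σ` of `X`. -/
def charMap (X : SSet.{u}) {n : ℕ} (σ : Splx X n) :
    C(stdSimplex ℝ (Fin (n + 1)), SSet.toTop.obj X) :=
  TopCat.toSSetObjEquiv _ _ ((sSetTopAdj.unit.app X).app (op (SimplexCategory.mk n)) σ)

theorem charMap_map (X : SSet.{u}) {m n : ℕ} (f : SimplexCategory.mk m ⟶ SimplexCategory.mk n)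
    (σ : Splx X n)
    (z : stdSimplex ℝ (Fin (m + 1))) :
    charMap X (X.map f.op σ) z = charMap X σ (stdSimplex.map f z) := by
  unfold charMap
  have h := ConcreteCategory.congr_hom ((sSetTopAdj.unit.app X).naturality f.op) σ
  exact congrArg (fun t => TopCat.toSSetObjEquiv _ _ t z) h

/-- The point of `|X|` given by a vertex of `X`. -/
def pt (X : SSet.{u}) (v : Splx X 0) : SSet.toTop.obj X := charMap X v (stdSimplex.vertex 0)

theorem charMap_vertex (X : SSet.{u}) {n : ℕ} (σ : Splx X n) (i : Fin (n + 1)) :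
    charMap X σ (stdSimplex.vertex i) =
      pt X (X.map (SimplexCategory.const (.mk 0) (.mk n) i).op σ) := by
  rw [pt, charMap_map, stdSimplex.map_vertex]
  rfl

theorem charMap_natural {X Y : SSet.{u}} (f : X ⟶ Y) {n : ℕ} (σ : Splx X n)
    (z : stdSimplex ℝ (Fin (n + 1))) :
    SSet.toTop.map f (charMap X σ z) = charMap Y (f.app _ σ) z := by
  unfold charMap
  have h := ConcreteCategory.congr_hom 
    (congr_app (sSetTopAdj.unit.naturality f) (op (SimplexCategory.mk n))) σ
  exact (congrArg (fun t => TopCat.toSSetObjEquiv _ _ t z) h).symm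

theorem map_pt {X Y : SSet.{u}} (f : X ⟶ Y) (v : Splx X 0) :
    SSet.toTop.map f (pt X v) = pt Y (f.app _ v) :=
  charMap_natural f v _

/-- The straight path from the `i`-th to the `j`-th vertex of `Δⁿ`. -/
def seg {n : ℕ} (i j : Fin (n + 1)) (h : i ≤ j) :
    Path (stdSimplex.vertex (S := ℝ) i) (stdSimplex.vertex j) where
  toFun t := stdSimplex.map (SimplexCategory.mkOfLe i j h) (stdSimplexHomeomorphUnitInterval.symm t)
  continuous_toFun := (stdSimplex.continuous_map _).comp
    stdSimplexHomeomorphUnitInterval.symm.continuous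
  source' := by
    have : stdSimplexHomeomorphUnitInterval.symm 0 = stdSimplex.vertex 0 := by
      rw [Homeomorph.symm_apply_eq]; rfl
    rw [this, stdSimplex.map_vertex]; rfl
  target' := by
    have : stdSimplexHomeomorphUnitInterval.symm 1 = stdSimplex.vertex 1 := by
      rw [Homeomorph.symm_apply_eq]; rfl
    rw [this, stdSimplex.map_vertex]; rfl

theorem const_zero_eq : SimplexCategory.const (.mk 0) (.mk 1) 0 = SimplexCategory.δ 1 := by
  ext i; fin_cases i; rfl

theorem const_one_eq : SimplexCategory.const (.mk 0) (.mk 1) 1 = SimplexCategory.δ 0 := by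
  ext i; fin_cases i; rfl

/-- The path `t ↦ (1 - t, t)` along an edge of `X`, as a path in `|X|`. -/
def edgePath {X : SSet.{u}} {a b : Splx X 0} (e : X.Edge a b) : Path (pt X a) (pt X b) where
  toFun t := charMap X e.edge (stdSimplexHomeomorphUnitInterval.symm t)
  continuous_toFun := (charMap X e.edge).continuous.comp
    stdSimplexHomeomorphUnitInterval.symm.continuous
  source' := by
    have : stdSimplexHomeomorphUnitInterval.symm 0 = stdSimplex.vertex 0 := by
      rw [Homeomorph.symm_apply_eq]; rfl
    rw [this, charMap_vertex, const_zero_eq]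
    exact congrArg (pt X) e.src_eq
  target' := by
    have : stdSimplexHomeomorphUnitInterval.symm 1 = stdSimplex.vertex 1 := by
      rw [Homeomorph.symm_apply_eq]; rfl
    rw [this, charMap_vertex, const_one_eq]
    exact congrArg (pt X) e.tgt_eq

/-- The class of `edgePath e`, as a morphism of the fundamental groupoid of `|X|`
(composition there is in path order: `p ≫ q` is first `p`, then `q`). -/
def edgeHom {X : SSet.{u}} {a b : Splx X 0} (e : X.Edge a b) :
    FundamentalGroupoid.mk (pt X a) ⟶ FundamentalGroupoid.mk (pt X b) :=
  Path.Homotopic.Quotient.mk (edgePath e)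

theorem edgePath_eq_seg {X : SSet.{u}} {n : ℕ} (σ : Splx X n) (i j : Fin (n + 1)) (h : i ≤ j)
    {a b : Splx X 0} (e : X.Edge a b) (he : e.edge = X.map (SimplexCategory.mkOfLe i j h).op σ)
    (ha : pt X a = charMap X σ (stdSimplex.vertex i))
    (hb : pt X b = charMap X σ (stdSimplex.vertex j)) :
    edgePath e = ((seg i j h).map (charMap X σ).continuous).cast ha hb := by
  ext t
  change charMap X e.edge _ = charMap X σ (stdSimplex.map _ _)
  rw [he, charMap_map]

theorem pt_src_eq {X : SSet.{u}} {n : ℕ} (σ : Splx X n) (i j : Fin (n + 1)) (h : i ≤ j)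
    {a b : Splx X 0} (e : X.Edge a b) (he : e.edge = X.map (SimplexCategory.mkOfLe i j h).op σ) :
    pt X a = charMap X σ (stdSimplex.vertex i) := by
  rw [charMap_vertex, ← e.src_eq, he]
  change pt X (X.map _ _) = _
  rw [← CategoryTheory.comp_apply, ← X.map_comp, ← op_comp]
  congr 4
  exact congrArg Quiver.Hom.op (SimplexCategory.Hom.ext_zero_left _ _ rfl)

theorem pt_tgt_eq {X : SSet.{u}} {n : ℕ} (σ : Splx X n) (i j : Fin (n + 1)) (h : i ≤ j)
    {a b : Splx X 0} (e : X.Edge a b) (he : e.edge = X.map (SimplexCategory.mkOfLe i j h).op σ) :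
    pt X b = charMap X σ (stdSimplex.vertex j) := by
  rw [charMap_vertex, ← e.tgt_eq, he]
  change pt X (X.map _ _) = _
  rw [← CategoryTheory.comp_apply, ← X.map_comp, ← op_comp]
  congr 4
  exact congrArg Quiver.Hom.op (SimplexCategory.Hom.ext_zero_left _ _ rfl)

theorem edgeHom_comp {X : SSet.{u}} {a b c : Splx X 0} {e₀₁ : X.Edge a b} {e₁₂ : X.Edge b c}
    {e₀₂ : X.Edge a c} (s : SSet.Edge.CompStruct e₀₁ e₁₂ e₀₂) :
    edgeHom e₀₁ ≫ edgeHom e₁₂ = edgeHom e₀₂ := by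
  have : ContractibleSpace (stdSimplex ℝ (Fin 3)) :=
    (convex_stdSimplex ℝ (Fin 3)).contractibleSpace ⟨_, single_mem_stdSimplex ℝ 0⟩
  have h01 : e₀₁.edge = X.map (SimplexCategory.mkOfLe (0 : Fin 3) 1 (by decide)).op s.simplex := by
    rw [← s.d₂]
    have : SimplexCategory.mkOfLe (0 : Fin 3) 1 (by decide) = SimplexCategory.δ 2 := by decide
    rw [this]; rfl
  have h12 : e₁₂.edge = X.map (SimplexCategory.mkOfLe (1 : Fin 3) 2 (by decide)).op s.simplex := by
    rw [← s.d₀]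
    have : SimplexCategory.mkOfLe (1 : Fin 3) 2 (by decide) = SimplexCategory.δ 0 := by decide
    rw [this]; rfl
  have h02 : e₀₂.edge = X.map (SimplexCategory.mkOfLe (0 : Fin 3) 2 (by decide)).op s.simplex := by
    rw [← s.d₁]
    have : SimplexCategory.mkOfLe (0 : Fin 3) 2 (by decide) = SimplexCategory.δ 1 := by decide
    rw [this]; rfl
  have ha := pt_src_eq s.simplex _ _ _ e₀₁ h01
  have hb := pt_src_eq s.simplex _ _ _ e₁₂ h12
  have hc := pt_tgt_eq s.simplex _ _ _ e₁₂ h12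
  rw [FundamentalGroupoid.comp_eq]
  unfold edgeHom
  rw [← Path.Homotopic.Quotient.mk_trans, Path.Homotopic.Quotient.eq,
    edgePath_eq_seg s.simplex _ _ _ e₀₁ h01 ha hb, edgePath_eq_seg s.simplex _ _ _ e₁₂ h12 hb hc,
    edgePath_eq_seg s.simplex _ _ _ e₀₂ h02 ha hc]
  have key := (SimplyConnectedSpace.paths_homotopic
    ((seg (0 : Fin 3) 1 (by decide)).trans (seg 1 2 (by decide)))
    (seg 0 2 (by decide))).map (charMap X s.simplex)
  have := key.pathCast ha hc
  convert! this using 1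
  rw [Path.map_trans]
  rfl

theorem edgeHom_id {X : SSet.{u}} (a : Splx X 0) : edgeHom (SSet.Edge.id a) = 𝟙 _ := by
  have h := edgeHom_comp (SSet.Edge.CompStruct.idComp (SSet.Edge.id a))
  exact (cancel_epi (edgeHom (SSet.Edge.id a))).1 (by rw [h, Category.comp_id])

/-- Edge walks in `X` from one vertex to another: sequences of consecutive edges, each traversed
forwards (`fwd`) or backwards (`bwd`). -/
inductive EdgeWalk (X : SSet.{u}) : Splx X 0 → Splx X 0 → Type u
  | nil (a : Splx X 0) : EdgeWalk X a a
  | fwd {a b c : Splx X 0} (e : X.Edge a b) (p : EdgeWalk X b c) : EdgeWalk X a c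
  | bwd {a b c : Splx X 0} (e : X.Edge b a) (p : EdgeWalk X b c) : EdgeWalk X a c

/-- The edges of a walk, with the direction in which they are traversed. -/
def EdgeWalk.edges {X : SSet.{u}} {a b : Splx X 0} : EdgeWalk X a b → List (Splx X 1 × Bool)
  | .nil _ => []
  | .fwd e p => (e.edge, true) :: p.edges
  | .bwd e p => (e.edge, false) :: p.edges

/-- The class in the fundamental groupoid of `|X|` of the path described by an edge walk. -/
def EdgeWalk.hom {X : SSet.{u}} {a b : Splx X 0} :
    EdgeWalk X a b → (FundamentalGroupoid.mk (pt X a) ⟶ FundamentalGroupoid.mk (pt X b))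
  | .nil _ => 𝟙 _
  | .fwd e p => edgeHom e ≫ p.hom
  | .bwd e p => Groupoid.inv (edgeHom e) ≫ p.hom

/-- A walk that uses only edges of `T` and never traverses the same edge back and forth
in two consecutive steps. -/
def EdgeWalk.IsReducedIn {X : SSet.{u}} {a b : Splx X 0} (p : EdgeWalk X a b)
    (T : Set (Splx X 1)) : Prop :=
  (∀ s ∈ p.edges, s.1 ∈ T) ∧ FreeGroup.IsReduced p.edges

/-- `T` is the set of edges of a maximal (that is, spanning) tree of the `1`-skeleton of `X`:
it consists of non-degenerate edges, and any two vertices of `X` are joined by exactly one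
walk without backtracking in `T`. -/
structure IsMaximalTree (X : SSet.{u}) (T : Set (Splx X 1)) : Prop where
  nonDegenerate : T ⊆ X.nonDegenerate 1
  existsUnique_walk : ∀ a b : Splx X 0, ∃! p : EdgeWalk X a b, p.IsReducedIn T

/-- The walk from `a` to `b` in the maximal tree `T`. -/
def IsMaximalTree.walk {X : SSet.{u}} {T : Set (Splx X 1)} (hT : IsMaximalTree X T)
    (a b : Splx X 0) : EdgeWalk X a b :=
  (hT.existsUnique_walk a b).choose

theorem IsMaximalTree.walk_isReducedIn {X : SSet.{u}} {T : Set (Splx X 1)}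
    (hT : IsMaximalTree X T) (a b : Splx X 0) : (hT.walk a b).IsReducedIn T :=
  (hT.existsUnique_walk a b).choose_spec.1

theorem IsMaximalTree.eq_walk {X : SSet.{u}} {T : Set (Splx X 1)} (hT : IsMaximalTree X T)
    {a b : Splx X 0} (p : EdgeWalk X a b) (hp : p.IsReducedIn T) : p = hT.walk a b :=
  (hT.existsUnique_walk a b).choose_spec.2 p hp

theorem IsMaximalTree.edgeHom_comp_walk {X : SSet.{u}} {T : Set (Splx X 1)}
    (hT : IsMaximalTree X T) {a b : Splx X 0} (e : X.Edge a b) (he : e.edge ∈ T) (v : Splx X 0) :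
    edgeHom e ≫ (hT.walk b v).hom = (hT.walk a v).hom := by
  obtain ⟨hm, hr⟩ := hT.walk_isReducedIn b v
  by_cases hred : FreeGroup.IsReduced (EdgeWalk.fwd e (hT.walk b v)).edges
  · rw [← hT.eq_walk (.fwd e (hT.walk b v)) ⟨?_, hred⟩]
    · rfl
    · intro s hs
      rcases List.mem_cons.1 hs with rfl | hs
      exacts [he, hm s hs]
  · generalize hw : hT.walk b v = w at *
    cases w with
    | nil => exact absurd FreeGroup.IsReduced.singleton hred
    | fwd e' p =>
      exact absurd (List.isChain_cons_cons.2 ⟨fun _ => rfl, hr⟩) hred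
    | bwd e' p =>
      have hee : e.edge = e'.edge := by
        by_contra hne
        exact hred (List.isChain_cons_cons.2 ⟨fun h => absurd h hne, hr⟩)
      obtain rfl : _ = a := by rw [← e.src_eq, hee, e'.src_eq]
      obtain rfl : e = e' := SSet.Edge.ext hee
      have hp : p.IsReducedIn T := ⟨fun s hs => hm s (List.mem_cons_of_mem _ hs),
        List.IsChain.of_cons hr⟩
      rw [← hT.eq_walk p hp]
      change edgeHom e ≫ Groupoid.inv (edgeHom e) ≫ p.hom = p.hom
      rw [← Category.assoc, Groupoid.comp_inv, Category.id_comp]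

/-- The fundamental group of `|X|` at the vertex `v` with multiplication in path order:
the product `[γ] * [δ]` is the class of the loop that runs first along `γ` and then along `δ`.
(Mathlib's `FundamentalGroup` has the opposite multiplication.) -/
abbrev Pi1 (X : SSet.{u}) (v : Splx X 0) : Type u :=
  (FundamentalGroup (SSet.toTop.obj X) (pt X v))ᵐᵒᵖ

section Construction

variable {X : SSet.{u}} {T : Set (Splx X 1)} (hT : IsMaximalTree X T) (v : Splx X 0)

/-- The generator `g_e` of the fundamental group given by an edge `e`: the class of the loop that
runs in `T` from `v` to the source of `e`, then along `e`, and then in `T` back to `v`. -/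
def edgeLoop {a b : Splx X 0} (e : X.Edge a b) : Pi1 X v :=
  MulOpposite.op (Groupoid.inv (hT.walk a v).hom ≫ edgeHom e ≫ (hT.walk b v).hom)

theorem edgeLoop_comp {a b c : Splx X 0} {e₀₁ : X.Edge a b} {e₁₂ : X.Edge b c}
    {e₀₂ : X.Edge a c} (s : SSet.Edge.CompStruct e₀₁ e₁₂ e₀₂) :
    edgeLoop hT v e₀₂ = edgeLoop hT v e₀₁ * edgeLoop hT v e₁₂ := by
  unfold edgeLoop
  rw [← MulOpposite.op_mul, CategoryTheory.End.mul_def, ← edgeHom_comp s]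
  congr 1
  simp only [Category.assoc]
  rw [← Category.assoc (hT.walk b v).hom, Groupoid.comp_inv, Category.id_comp]

theorem edgeLoop_of_mem {a b : Splx X 0} (e : X.Edge a b) (he : e.edge ∈ T) :
    edgeLoop hT v e = 1 := by
  unfold edgeLoop
  rw [hT.edgeHom_comp_walk e he, Groupoid.inv_comp]
  rfl

theorem edgeLoop_id (a : Splx X 0) : edgeLoop hT v (SSet.Edge.id a) = 1 := by
  unfold edgeLoop
  rw [edgeHom_id, Category.id_comp, Groupoid.inv_comp]
  rfl

variable {H : Type u} [Group H] (χ : Pi1 X v →* H)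

/-- The map `τ : X → H`, by recursion on the dimension: `1` on vertices, `χ(g_e)` on edges `e`,
and `τ(σ) = τ(∂₀σ)` in dimension at least two. (It is `1` on the edges of `T` and on
degenerate edges, see `tau_of_mem` and `tau_degenerate`.) -/
def tau : (n : ℕ) → Splx X n → H
  | 0, _ => 1
  | 1, e => χ (edgeLoop hT v (SSet.Edge.mk' e))
  | n + 2, σ => tau (n + 1) (X.δ 0 σ)

theorem tau_edge {a b : Splx X 0} (e : X.Edge a b) :
    tau hT v χ 1 e.edge = χ (edgeLoop hT v e) := by
  obtain ⟨s, rfl, rfl⟩ := e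
  rfl

theorem tau_of_mem (e : Splx X 1) (he : e ∈ T) : tau hT v χ 1 e = 1 := by
  rw [tau, edgeLoop_of_mem hT v (SSet.Edge.mk' e) he, map_one]

theorem tau_degenerate (a : Splx X 0) : tau hT v χ 1 (X.σ 0 a) = 1 := by
  rw [← SSet.Edge.id_edge, tau_edge, edgeLoop_id, map_one]

theorem tau_two (σ : Splx X 2) :
    tau hT v χ 1 (X.δ 1 σ) = tau hT v χ 1 (X.δ 2 σ) * tau hT v χ 1 (X.δ 0 σ) := by
  obtain ⟨a, b, c, e₀₁, e₁₂, e₀₂, s, rfl⟩ := SSet.Edge.CompStruct.exists_of_simplex σ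
  rw [s.d₀, s.d₁, s.d₂, tau_edge, tau_edge, tau_edge, edgeLoop_comp hT v s, map_mul]

/-- The value of `τ` on the edge of `σ` from its `i`-th to its `j`-th vertex. -/
def tauEdge {n : ℕ} (σ : Splx X n) (i j : Fin (n + 1)) (h : i ≤ j) : H :=
  tau hT v χ 1 (X.map (SimplexCategory.mkOfLe i j h).op σ)

theorem tauEdge_self {n : ℕ} (σ : Splx X n) (i : Fin (n + 1)) :
    tauEdge hT v χ σ i i le_rfl = 1 := by
  unfold tauEdge
  have : SimplexCategory.mkOfLe i i le_rfl =
      SimplexCategory.σ 0 ≫ SimplexCategory.const (.mk 0) (.mk n) i := by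
    refine SimplexCategory.Hom.ext_one_left _ _ ?_ ?_ <;> rfl
  rw [this, op_comp, X.map_comp]
  exact tau_degenerate hT v χ _

theorem tauEdge_trans {n : ℕ} (σ : Splx X n) (i j k : Fin (n + 1)) (h₁ : i ≤ j) (h₂ : j ≤ k) :
    tauEdge hT v χ σ i k (h₁.trans h₂) = tauEdge hT v χ σ i j h₁ * tauEdge hT v χ σ j k h₂ := by
  have h := tau_two hT v χ (X.map (SimplexCategory.mkOfLeComp i j k h₁ h₂).op σ)
  unfold tauEdge
  convert! h using 2
  · change _ = X.map _ (X.map _ _)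
    rw [← CategoryTheory.comp_apply, ← X.map_comp, ← op_comp]
    congr 3
    exact congrArg Quiver.Hom.op (SimplexCategory.Hom.ext_one_left _ _ rfl rfl)
  · congr 1
    change _ = X.map _ (X.map _ _)
    rw [← CategoryTheory.comp_apply, ← X.map_comp, ← op_comp]
    congr 3
    exact congrArg Quiver.Hom.op (SimplexCategory.Hom.ext_one_left _ _ rfl rfl)
  · congr 1
    change _ = X.map _ (X.map _ _)
    rw [← CategoryTheory.comp_apply, ← X.map_comp, ← op_comp]
    congr 3
    exact congrArg Quiver.Hom.op (SimplexCategory.Hom.ext_one_left _ _ rfl rfl)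

theorem tauEdge_map {m n : ℕ} (f : SimplexCategory.mk m ⟶ SimplexCategory.mk n)
    (σ : Splx X n) (i j : Fin (m + 1)) (h : i ≤ j) :
    tauEdge hT v χ (X.map f.op σ) i j h =
      tauEdge hT v χ σ (f.toOrderHom i) (f.toOrderHom j) (f.toOrderHom.monotone h) := by
  unfold tauEdge
  rw [← CategoryTheory.comp_apply, ← X.map_comp, ← op_comp]
  congr 4
  exact congrArg Quiver.Hom.op (SimplexCategory.Hom.ext_one_left _ _ rfl rfl)

/-- In positive dimension, `τ(σ)` is the value of `τ` on the last edge of `σ`. -/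
theorem tau_eq_tauEdge (n : ℕ) (σ : Splx X (n + 1)) :
    tau hT v χ (n + 1) σ =
      tauEdge hT v χ σ (Fin.last n).castSucc (Fin.last (n + 1)) (Fin.le_last _) := by
  induction n with
  | zero =>
    unfold tauEdge
    have : SimplexCategory.mkOfLe (Fin.last 0).castSucc (Fin.last 1) (Fin.le_last _) = 𝟙 _ := by
      refine SimplexCategory.Hom.ext_one_left _ _ ?_ ?_ <;> rfl
    rw [this, op_id, X.map_id]
    rfl
  | succ n ih =>
    rw [tau, ih]
    exact tauEdge_map hT v χ (SimplexCategory.δ 0) σ _ _ _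

/-- The simplicial set `X̃`: its `n`-simplices are the pairs `(h, σ)` with `h : H` and `σ` an
`n`-simplex of `X`. The action of a monotone map `f : [m] → [n]` multiplies `h` on the right by
the inverse of `τ` of the edge of `σ` from its vertex `f m` to its last vertex; on faces and
degeneracies this is `cover_δ_castSucc`, `cover_δ_last` and `cover_σ`. -/
def cover : SSet.{u} where
  obj n := H × X.obj n
  map {n m} f := ↾fun p =>
    (p.1 * (tauEdge hT v χ (n := n.unop.len) p.2
      (f.unop.toOrderHom (Fin.last m.unop.len)) (Fin.last n.unop.len) (Fin.le_last _))⁻¹,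
      X.map f p.2)
  map_id n := by
    ext p
    · change p.1 * (tauEdge hT v χ (n := n.unop.len) p.2 (Fin.last n.unop.len) _ _)⁻¹ = p.1
      rw [tauEdge_self, inv_one, mul_one]
    · change X.map _ p.2 = p.2
      rw [X.map_id]; rfl
  map_comp {n m l} f g := by
    ext p
    · change p.1 * (tauEdge hT v χ (n := n.unop.len) p.2
          (f.unop.toOrderHom (g.unop.toOrderHom (Fin.last l.unop.len))) (Fin.last _) _)⁻¹ =
        p.1 * _ * (tauEdge hT v χ (n := m.unop.len) (X.map f p.2) _ _ _)⁻¹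
      have h : tauEdge hT v χ (n := m.unop.len) (X.map f p.2)
          (g.unop.toOrderHom (Fin.last l.unop.len)) (Fin.last m.unop.len) (Fin.le_last _) = _ :=
        tauEdge_map hT v χ (m := m.unop.len) (n := n.unop.len) f.unop p.2 _ _ (Fin.le_last _)
      rw [h, mul_assoc, ← mul_inv_rev, ← tauEdge_trans]
    · change X.map _ p.2 = X.map _ (X.map _ p.2)
      rw [X.map_comp]; rfl

/-- `∂ᵢ(h, σ) = (h, ∂ᵢσ)` for `i < n`. -/
theorem cover_δ_castSucc (n : ℕ) (i : Fin (n + 1)) (h : H) (σ : Splx X (n + 1)) :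
    (cover hT v χ).δ i.castSucc (h, σ) = (h, X.δ i.castSucc σ) := by
  refine Prod.ext ?_ rfl
  change h * (tauEdge hT v χ σ (i.castSucc.succAbove (Fin.last n)) (Fin.last (n + 1)) _)⁻¹ = h
  have : i.castSucc.succAbove (Fin.last n) = Fin.last (n + 1) := by
    rw [Fin.succAbove_of_le_castSucc _ _ (Fin.castSucc_le_castSucc_iff.2 (Fin.le_last i))]
    rfl
  simp only [this, tauEdge_self, inv_one, mul_one]

/-- `∂ₙ(h, σ) = (h * τ(σ)⁻¹, ∂ₙσ)`. -/
theorem cover_δ_last (n : ℕ) (h : H) (σ : Splx X (n + 1)) :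
    (cover hT v χ).δ (Fin.last (n + 1)) (h, σ) =
      (h * (tau hT v χ (n + 1) σ)⁻¹, X.δ (Fin.last (n + 1)) σ) := by
  refine Prod.ext ?_ rfl
  change h * (tauEdge hT v χ σ ((Fin.last (n + 1)).succAbove (Fin.last n)) _ _)⁻¹ = _
  rw [tau_eq_tauEdge]
  simp only [Fin.succAbove_last]

/-- `sᵢ(h, σ) = (h, sᵢσ)`. -/
theorem cover_σ (n : ℕ) (i : Fin (n + 1)) (h : H) (σ : Splx X n) :
    (cover hT v χ).σ i (h, σ) = (h, X.σ i σ) := by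
  refine Prod.ext ?_ rfl
  change h * (tauEdge hT v χ σ (i.predAbove (Fin.last (n + 1))) (Fin.last n) _)⁻¹ = h
  have : i.predAbove (Fin.last (n + 1)) = Fin.last n := by
    rw [Fin.predAbove_of_castSucc_lt _ _ (Fin.castSucc_lt_last i)]
    rfl
  simp only [this, tauEdge_self, inv_one, mul_one]

/-- The simplicial map `π : X̃ → X`, `(h, σ) ↦ σ`. -/
def proj : cover hT v χ ⟶ X where
  app n := ↾fun p => p.2

/-- The continuous map `|X̃| → |X|` induced by `π`. -/
def projTop : C(SSet.toTop.obj (cover hT v χ), SSet.toTop.obj X) := (SSet.toTop.map (proj hT v χ)).hom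

/-- The base point `(1, v)` of `|X̃|`. -/
def basePt : SSet.toTop.obj (cover hT v χ) := pt (cover hT v χ) ((1, v) : H × Splx X 0)

theorem projTop_basePt : projTop hT v χ (basePt hT v χ) = pt X v :=
  map_pt (proj hT v χ) _

end Construction

end

end SimplicialCover

open SimplicialCover

namespace SimplicialCover

open CategoryTheory Opposite

/-! ### Maps out of the geometric realization, tested on simplices. -/

section Realization

variable {X : SSet.{u}}

/-! Covering property. `H` acts on `|X̃|` by left multiplication on the first component; `|π|` is a
quotient map whose fibres are the orbits, so it suffices that every point has a neighbourhood
disjoint from its translates by `h ≠ 1`. Cut `[0, 1)` into consecutive intervals whose lengths are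
barycentric coordinates and label each interval by the `H`-component of the corresponding vertex.
This is compatible with all simplicial operators, so every point of `|X̃|` receives a step function
`[0, 1) → H`, equivariantly. The measure of the set where it differs from a fixed function is
continuous (`continuous_stepDist`). If `y` and `h • y` both differ from the step function of `x` on
a set of measure less than `1/2`, all three agree somewhere, which forces `h = 1`
(`isQuotientCoveringMap_projTop`).

Monodromy. An edge `e` lifted from `(h, ∂₁e)` ends at `(h * χ(g_e), ∂₀e)`, and tree edges do not
change `h`. So the monodromy homomorphism agrees with `χ` on every `g_e`, and everywhere once the
`g_e` generate (`eq_top_of_edgeLoop_mem`, `toMulOpposite_eq`). The image of `|π|_*` is the kernel of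
monodromy, hence `ker χ`; surjectivity of `χ` gives path-connectedness, and injectivity makes the
fundamental group of the cover trivial.

Generation, without van Kampen. Let `G` be a subgroup containing all `g_e`. Homotopy classes of
paths from `v` modulo `G` have a section over `|X|`: run in the tree to the first vertex of a
simplex, then inside the simplex. Paths in a single simplex preserve this section. If all paths
preserve it, then so does every loop at `v`, and this puts the loop in `G`. The passage to all paths
is `PathClass.ContainsSimplices.mem`: a path lies in some skeleton by compactness, and by induction
on dimension it is locally either in an open cell or in a collar that deforms into the lower
skeleton. -/

theorem charMap_naturality_toSSet {Y : TopCat.{u}} (φ : X ⟶ TopCat.toSSet.obj Y) {n : ℕ}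
    (σ : Splx X n) (z : stdSimplex ℝ (Fin (n + 1))) :
    ((sSetTopAdj.homEquiv X Y).symm φ) (charMap X σ z) =
      TopCat.toSSetObjEquiv Y _ (φ.app _ σ) z := by
  have h := (sSetTopAdj.homEquiv X Y).apply_symm_apply φ
  rw [Adjunction.homEquiv_unit] at h
  have h' := ConcreteCategory.congr_hom (congr_app h (op (SimplexCategory.mk n))) σ
  exact congrArg (fun t => TopCat.toSSetObjEquiv Y _ t z) h'

/-- A natural family of continuous maps on the simplices of `X` descends to `|X|`. -/
theorem exists_continuousMap_charMap {Y : Type u} [TopologicalSpace Y]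
    (g : ∀ n, Splx X n → C(stdSimplex ℝ (Fin (n + 1)), Y))
    (hg : ∀ (m n : ℕ) (f : SimplexCategory.mk m ⟶ SimplexCategory.mk n) (σ : Splx X n) z,
      g m (X.map f.op σ) z = g n σ (stdSimplex.map f z)) :
    ∃ G : C(SSet.toTop.obj X, Y), ∀ n (σ : Splx X n) z, G (charMap X σ z) = g n σ z := by
  let φ : X ⟶ TopCat.toSSet.obj (TopCat.of Y) :=
    { app := fun n => ↾fun σ => (TopCat.toSSetObjEquiv (TopCat.of Y) n).symm (g n.unop.len σ)
      naturality := by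
        intro n m f
        ext σ
        apply (TopCat.toSSetObjEquiv (TopCat.of Y) m).injective
        ext z
        exact hg m.unop.len n.unop.len f.unop σ z }
  refine ⟨((sSetTopAdj.homEquiv X (TopCat.of Y)).symm φ).hom, fun n σ z => ?_⟩
  exact charMap_naturality_toSSet φ σ z

theorem toTop_hom_ext {Y : Type u} [TopologicalSpace Y] {f g : C(SSet.toTop.obj X, Y)}
    (h : ∀ n (σ : Splx X n) z, f (charMap X σ z) = g (charMap X σ z)) : f = g := by
  have : TopCat.ofHom f = TopCat.ofHom g := by
    apply (sSetTopAdj.homEquiv X (TopCat.of Y)).injective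
    rw [Adjunction.homEquiv_unit, Adjunction.homEquiv_unit]
    ext n σ
    apply (TopCat.toSSetObjEquiv (TopCat.of Y) n).injective
    ext z
    exact h n.unop.len σ z
  exact congrArg TopCat.Hom.hom this

/-- With the indiscrete topology on truth values every predicate is continuous, so being a point of
some simplex and being true, which agree on all simplices, agree everywhere. -/
theorem exists_charMap_eq (x : SSet.toTop.obj X) :
    ∃ (n : ℕ) (σ : Splx X n) (z : stdSimplex ℝ (Fin (n + 1))), charMap X σ z = x := by
  let : TopologicalSpace (ULift.{u} Prop) := ⊤
  let f : C(SSet.toTop.obj X, ULift.{u} Prop) :=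
    ⟨fun x => ⟨∃ (n : ℕ) (σ : Splx X n) (z : stdSimplex ℝ (Fin (n + 1))), charMap X σ z = x⟩,
      continuous_top⟩
  have : f = ⟨fun _ => ⟨True⟩, continuous_top⟩ := by
    refine toTop_hom_ext fun n σ z => ?_
    exact congrArg ULift.up (eq_true ⟨n, σ, z, rfl⟩)
  have h := congrArg (fun g => (g x).down) this
  exact of_eq_true h

/-- A natural family of functions on the simplices of `X` takes equal values on points of
simplices that are identified in `|X|`. -/
theorem eq_of_charMap_eq {Y : Sort*}
    (g : ∀ n, Splx X n → stdSimplex ℝ (Fin (n + 1)) → Y)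
    (hg : ∀ (m n : ℕ) (f : SimplexCategory.mk m ⟶ SimplexCategory.mk n) (σ : Splx X n) z,
      g m (X.map f.op σ) z = g n σ (stdSimplex.map f z))
    {m n : ℕ} {σ : Splx X m} {τ : Splx X n} {z w} (h : charMap X σ z = charMap X τ w) :
    g m σ z = g n τ w := by
  -- The predicate of having the same value as `(τ, w)` is natural, and for the indiscrete topology
  -- it is continuous, so it descends to `|X|`.
  let : TopologicalSpace (ULift.{u} Prop) := ⊤
  obtain ⟨G, hG⟩ := exists_continuousMap_charMap (X := X) (Y := ULift.{u} Prop)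
    (fun k ρ => ⟨fun t => ⟨g k ρ t = g n τ w⟩, continuous_top⟩)
    (fun k l f ρ t => congrArg ULift.up (by
      rw [hg]))
  have h1 : (G (charMap X τ w)).down := by rw [hG]; exact rfl
  rw [← h, hG] at h1
  exact h1

/-- A natural family of functions on the simplices of `X` descends to `|X|`. -/
theorem exists_function_charMap {Y : Sort*}
    (g : ∀ n, Splx X n → stdSimplex ℝ (Fin (n + 1)) → Y)
    (hg : ∀ (m n : ℕ) (f : SimplexCategory.mk m ⟶ SimplexCategory.mk n) (σ : Splx X n) z,
      g m (X.map f.op σ) z = g n σ (stdSimplex.map f z)) :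
    ∃ G : SSet.toTop.obj X → Y, ∀ n (σ : Splx X n) z, G (charMap X σ z) = g n σ z := by
  choose n σ z h using exists_charMap_eq (X := X)
  exact ⟨fun x => g _ (σ x) (z x), fun k τ w => eq_of_charMap_eq g hg (h _)⟩

/-- Continuity of functions on `|X|` can be checked on simplices. -/
theorem continuous_of_charMap {Y : Type*} [TopologicalSpace Y] {f : SSet.toTop.obj X → Y}
    (h : ∀ n (σ : Splx X n), Continuous fun z => f (charMap X σ z)) : Continuous f := by
  -- The final topology for the characteristic maps. The universal property of `|X|` makes the
  -- identity continuous into it, and `f` is continuous out of it by hypothesis.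
  let t : TopologicalSpace (SSet.toTop.obj X) :=
    ⨆ n, ⨆ σ : Splx X n, TopologicalSpace.coinduced (charMap X σ) inferInstance
  have ht : ∀ n (σ : Splx X n), @Continuous _ _ _ t (charMap X σ) := fun n σ =>
    continuous_iff_coinduced_le.2 (le_trans (le_iSup
      (fun σ : Splx X n => TopologicalSpace.coinduced (charMap X σ) inferInstance) σ)
      (le_iSup (fun n => ⨆ σ : Splx X n,
        TopologicalSpace.coinduced (charMap X σ) inferInstance) n))
  have hid : @Continuous _ _ (SSet.toTop.obj X).str t (id : SSet.toTop.obj X → SSet.toTop.obj X) := by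
    obtain ⟨G, hG⟩ := @exists_continuousMap_charMap X (SSet.toTop.obj X) t
      (fun n σ => @ContinuousMap.mk _ _ _ t (charMap X σ) (ht n σ))
      (fun m n f σ z => charMap_map X f σ z)
    have hid : id = @DFunLike.coe _ _ _
        (@ContinuousMap.instFunLike _ _ (SSet.toTop.obj X).str t) G := by
      funext x
      obtain ⟨n, σ, z, rfl⟩ := exists_charMap_eq x
      exact (hG n σ z).symm
    rw [hid]
    exact @ContinuousMap.continuous _ _ (SSet.toTop.obj X).str t G
  have hf : @Continuous _ _ t _ f := by
    rw [continuous_iff_le_induced]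
    refine iSup_le fun n => iSup_le fun σ => ?_
    rw [← continuous_iff_le_induced, continuous_coinduced_dom]
    exact h n σ
  exact @Continuous.comp _ _ _ (SSet.toTop.obj X).str t _ _ _ hf hid

theorem isClosed_of_charMap {C : Set (SSet.toTop.obj X)}
    (h : ∀ n (σ : Splx X n), IsClosed (charMap X σ ⁻¹' C)) : IsClosed C := by
  have : Continuous fun x => x ∉ C := by
    refine continuous_of_charMap fun n σ => ?_
    exact continuous_Prop.2 (h n σ).isOpen_compl
  exact ⟨continuous_Prop.1 this⟩

theorem isOpen_of_charMap {U : Set (SSet.toTop.obj X)}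
    (h : ∀ n (σ : Splx X n), IsOpen (charMap X σ ⁻¹' U)) : IsOpen U :=
  continuous_Prop.1 (continuous_of_charMap fun n σ => continuous_Prop.2 (h n σ))

theorem pathConnectedSpace_stdSimplex (n : ℕ) :
    PathConnectedSpace (stdSimplex ℝ (Fin (n + 1))) :=
  have : ContractibleSpace (stdSimplex ℝ (Fin (n + 1))) :=
    (convex_stdSimplex ℝ (Fin (n + 1))).contractibleSpace ⟨_, single_mem_stdSimplex ℝ 0⟩
  inferInstance

theorem simplyConnectedSpace_stdSimplex (n : ℕ) :
    SimplyConnectedSpace (stdSimplex ℝ (Fin (n + 1))) :=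
  have : ContractibleSpace (stdSimplex ℝ (Fin (n + 1))) :=
    (convex_stdSimplex ℝ (Fin (n + 1))).contractibleSpace ⟨_, single_mem_stdSimplex ℝ 0⟩
  inferInstance

end Realization

/-! ### Points of a simplex as subdivisions of the unit interval. -/

section StepIndex

open Finset

theorem sum_stdSimplex_map {m n : ℕ} (f : Fin (m + 1) → Fin (n + 1))
    (z : stdSimplex ℝ (Fin (m + 1))) (S : Finset (Fin (n + 1))) :
    ∑ j ∈ S, stdSimplex.map f z j = ∑ k with f k ∈ S, z k := by
  rw [stdSimplex.map_coe]
  simp_rw [FunOnFinite.linearMap_apply_apply]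
  rw [← Finset.sum_fiberwise_of_maps_to (s := univ.filter fun k => f k ∈ S) (t := S) (g := f)
    (fun k hk => (mem_filter.1 hk).2)]
  refine sum_congr rfl fun j hj => ?_
  refine sum_congr ?_ fun _ _ => rfl
  ext k
  simp only [mem_filter, mem_univ, true_and]
  constructor
  · rintro rfl
    exact ⟨hj, rfl⟩
  · exact fun h => h.2

/-- If `[0, 1)` is cut into consecutive half-open intervals whose lengths are the barycentric
coordinates of `z`, this is the index of the interval that contains `s`. -/
noncomputable def stepIndex {n : ℕ} (z : stdSimplex ℝ (Fin (n + 1))) (s : ℝ) : Fin (n + 1) :=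
  ({i | ∑ k ∈ Iio i, z k ≤ s} : Finset (Fin (n + 1))).sup id

theorem stepIndex_spec {n : ℕ} (z : stdSimplex ℝ (Fin (n + 1))) {s : ℝ} (h0 : 0 ≤ s) (h1 : s < 1) :
    ∑ k ∈ Iio (stepIndex z s), z k ≤ s ∧ s < ∑ k ∈ Iic (stepIndex z s), z k := by
  constructor
  -- The index `0` belongs to the set because its partial sum is empty, so the supremum is attained
  -- and is not a default value.
  · have hne : ({i | ∑ k ∈ Iio i, z k ≤ s} : Finset (Fin (n + 1))).Nonempty :=
      ⟨0, mem_filter.2 ⟨mem_univ _, by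
        have : Iio (0 : Fin (n + 1)) = ∅ := by ext k; simp
        rw [this]; simpa using h0⟩⟩
    obtain ⟨i, hi, h⟩ := exists_mem_eq_sup _ hne id
    rw [stepIndex, h]
    exact (mem_filter.1 hi).2
  · by_contra! h
    rcases Fin.eq_castSucc_or_eq_last (stepIndex z s) with ⟨j, hj⟩ | hj
    · have hmem : j.succ ∈ ({i | ∑ k ∈ Iio i, z k ≤ s} : Finset (Fin (n + 1))) := by
        refine mem_filter.2 ⟨mem_univ _, ?_⟩
        convert! h using 2
        rw [hj]
        ext k
        simp [Fin.lt_def, Fin.le_def]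
      have : j.succ ≤ stepIndex z s := le_sup (f := id) hmem
      rw [hj] at this
      exact absurd this (not_le.2 (Fin.castSucc_lt_succ))
    · rw [hj] at h
      have : (Iic (Fin.last n)) = univ := by ext k; simp [Fin.le_last]
      rw [this] at h
      have h2 : ∑ k, z k = 1 := z.2.2
      linarith

theorem eq_stepIndex {n : ℕ} (z : stdSimplex ℝ (Fin (n + 1))) {s : ℝ} (h0 : 0 ≤ s) (h1 : s < 1)
    {i : Fin (n + 1)} (hi : ∑ k ∈ Iio i, z k ≤ s) (hi' : s < ∑ k ∈ Iic i, z k) :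
    i = stepIndex z s := by
  obtain ⟨h, h'⟩ := stepIndex_spec z h0 h1
  have key : ∀ {a b : Fin (n + 1)}, s < ∑ k ∈ Iic a, z k → ∑ k ∈ Iio b, z k ≤ s → b ≤ a := by
    intro a b ha hb
    by_contra! hab
    have : ∑ k ∈ Iic a, z k ≤ ∑ k ∈ Iio b, z k :=
      sum_le_sum_of_subset_of_nonneg
        (fun k hk => mem_Iio.2 ((mem_Iic.1 hk).trans_lt hab)) fun k _ _ => z.2.1 k
    linarith
  exact le_antisymm (key h' hi) (key hi' h)

/-- A monotone map merges adjacent intervals and inserts empty ones, without moving any point of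
`[0, 1)`. Empty intervals are never selected because the intervals are half-open. -/
theorem stepIndex_map {m n : ℕ} (f : Fin (m + 1) →o Fin (n + 1))
    (z : stdSimplex ℝ (Fin (m + 1))) {s : ℝ} (h0 : 0 ≤ s) (h1 : s < 1) :
    stepIndex (stdSimplex.map f z) s = f (stepIndex z s) := by
  obtain ⟨h, h'⟩ := stepIndex_spec z h0 h1
  refine (eq_stepIndex _ h0 h1 ?_ ?_).symm
  · rw [sum_stdSimplex_map]
    refine le_trans (sum_le_sum_of_subset_of_nonneg (fun k hk => ?_) fun k _ _ => z.2.1 k) h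
    exact mem_Iio.2 (f.monotone.reflect_lt (mem_Iio.1 (mem_filter.1 hk).2))
  · rw [sum_stdSimplex_map]
    refine lt_of_lt_of_le h'
      (sum_le_sum_of_subset_of_nonneg (fun k hk => ?_) fun k _ _ => z.2.1 k)
    exact mem_filter.2 ⟨mem_univ _, mem_Iic.2 (f.monotone (mem_Iic.1 hk))⟩

/-- Moving from `z` to `w` can change the index at `s` only if some division point crosses `s`; this
bounds how much the step function changes. -/
theorem stepIndex_eq_of_forall {n : ℕ} {z w : stdSimplex ℝ (Fin (n + 1))} {s : ℝ}
    (h : ∀ i, s ∉ Set.uIcc (∑ k ∈ Iio i, z k) (∑ k ∈ Iio i, w k)) :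
    stepIndex z s = stepIndex w s := by
  unfold stepIndex
  congr 1
  ext i
  have := h i
  rw [Set.mem_uIcc] at this
  push Not at this
  simp only [mem_filter, mem_univ, true_and]
  constructor
  · intro h; by_contra! h'; linarith [this.1 h]
  · intro h; by_contra! h'; linarith [this.2 h]

end StepIndex

/-! ### The group action on the cover and the covering property. -/

section Covering

variable {X : SSet.{u}} {T : Set (Splx X 1)} (hT : IsMaximalTree X T) (v : Splx X 0)
  {H : Type u} [Group H] (χ : Pi1 X v →* H)

/-- The simplex `(h, σ)` of `X̃`. -/
def coverMk {n : ℕ} (h : H) (σ : Splx X n) : Splx (cover hT v χ) n := (h, σ)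

variable {hT v χ} in
/-- The component in `H` of a simplex of `X̃`. -/
def coverFst {n : ℕ} (p : Splx (cover hT v χ) n) : H := Prod.fst p

variable {hT v χ} in
/-- The simplex of `X` below a simplex of `X̃`. -/
def coverSnd {n : ℕ} (p : Splx (cover hT v χ) n) : Splx X n := Prod.snd p

/-- The deck transformation `(k, σ) ↦ (h * k, σ)` of `X̃`. -/
def deckHom (h : H) : cover hT v χ ⟶ cover hT v χ where
  app n := ↾fun p => (h * p.1, p.2)
  naturality n m f := by
    ext p
    exact Prod.ext (mul_assoc _ _ _).symm rfl

noncomputable instance : MulAction H (SSet.toTop.obj (cover hT v χ)) where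
  smul h x := SSet.toTop.map (deckHom hT v χ h) x
  one_smul x := by
    have : deckHom hT v χ 1 = 𝟙 _ := by
      ext n p
      exact Prod.ext (one_mul _) rfl
    change SSet.toTop.map _ x = x
    rw [this, SSet.toTop.map_id]
    rfl
  mul_smul a b x := by
    have : deckHom hT v χ (a * b) = deckHom hT v χ b ≫ deckHom hT v χ a := by
      ext n p
      exact Prod.ext (mul_assoc a b _) rfl
    change SSet.toTop.map _ x = SSet.toTop.map _ (SSet.toTop.map _ x)
    rw [this, SSet.toTop.map_comp]
    rfl

instance : ContinuousConstSMul H (SSet.toTop.obj (cover hT v χ)) where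
  continuous_const_smul h := (SSet.toTop.map (deckHom hT v χ h)).hom.continuous

theorem smul_charMap (h : H) {n : ℕ} (p : Splx (cover hT v χ) n)
    (z : stdSimplex ℝ (Fin (n + 1))) :
    h • charMap (cover hT v χ) p z =
      charMap (cover hT v χ) (coverMk hT v χ (h * coverFst p) (coverSnd p)) z :=
  charMap_natural (deckHom hT v χ h) p z

theorem projTop_charMap {n : ℕ} (p : Splx (cover hT v χ) n) (z : stdSimplex ℝ (Fin (n + 1))) :
    projTop hT v χ (charMap (cover hT v χ) p z) = charMap X (coverSnd p) z :=
  charMap_natural (proj hT v χ) p z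

/-- The first component of the `i`-th vertex of a simplex of `X̃`. -/
noncomputable def vertexLabel {n : ℕ} (p : Splx (cover hT v χ) n) (i : Fin (n + 1)) : H :=
  coverFst p * (tauEdge hT v χ (coverSnd p) i (Fin.last n) (Fin.le_last _))⁻¹

/-- The cocycle rule `tauEdge_trans` along `f i ≤ f m ≤ n`: the factor introduced by the operator
`f` is the one missing from the label of the restricted simplex. -/
theorem vertexLabel_map {m n : ℕ} (f : SimplexCategory.mk m ⟶ SimplexCategory.mk n)
    (p : Splx (cover hT v χ) n) (i : Fin (m + 1)) :
    vertexLabel hT v χ ((cover hT v χ).map f.op p) i =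
      vertexLabel hT v χ p (f.toOrderHom i) := by
  change coverFst p * (tauEdge hT v χ (coverSnd p) (f.toOrderHom (Fin.last m)) (Fin.last n) _)⁻¹ *
    (tauEdge hT v χ (X.map f.op (coverSnd p)) i (Fin.last m) _)⁻¹ = coverFst p * _
  rw [tauEdge_map, mul_assoc, ← mul_inv_rev, ← tauEdge_trans]

open Classical in
/-- The step function `[0, 1) → H` (extended by `1`) of a point of a simplex of `X̃`: its values
are the labels of the vertices, on intervals whose lengths are the barycentric coordinates. -/
noncomputable def simplexStep (n : ℕ) (p : Splx (cover hT v χ) n)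
    (z : stdSimplex ℝ (Fin (n + 1))) (s : ℝ) : H :=
  if s ∈ Set.Ico (0 : ℝ) 1 then vertexLabel hT v χ p (stepIndex z s) else 1

theorem simplexStep_map (m n : ℕ) (f : SimplexCategory.mk m ⟶ SimplexCategory.mk n)
    (p : Splx (cover hT v χ) n) (z : stdSimplex ℝ (Fin (m + 1))) :
    simplexStep hT v χ m ((cover hT v χ).map f.op p) z =
      simplexStep hT v χ n p (stdSimplex.map f z) := by
  funext s
  unfold simplexStep
  split_ifs with hs
  · rw [vertexLabel_map]
    congr 1
    exact (stepIndex_map f.toOrderHom z hs.1 hs.2).symm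
  · rfl

/-- The step function `[0, 1) → H` (extended by `1`) of a point of `|X̃|`. -/
noncomputable def stepFunction : SSet.toTop.obj (cover hT v χ) → ℝ → H :=
  (exists_function_charMap (simplexStep hT v χ) (simplexStep_map hT v χ)).choose

theorem stepFunction_charMap {n : ℕ} (p : Splx (cover hT v χ) n)
    (z : stdSimplex ℝ (Fin (n + 1))) :
    stepFunction hT v χ (charMap (cover hT v χ) p z) = simplexStep hT v χ n p z :=
  (exists_function_charMap (simplexStep hT v χ) (simplexStep_map hT v χ)).choose_spec n p z

theorem stepFunction_smul (h : H) (x : SSet.toTop.obj (cover hT v χ)) {s : ℝ}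
    (hs : s ∈ Set.Ico (0 : ℝ) 1) :
    stepFunction hT v χ (h • x) s = h * stepFunction hT v χ x s := by
  obtain ⟨n, p, z, rfl⟩ := exists_charMap_eq x
  rw [smul_charMap, stepFunction_charMap, stepFunction_charMap, simplexStep, simplexStep,
    if_pos hs, if_pos hs]
  exact mul_assoc _ _ _

open MeasureTheory

theorem measure_ne_top_of_subset_Ico {A : Set ℝ} (hA : A ⊆ Set.Ico (0 : ℝ) 1) :
    volume A ≠ ⊤ :=
  measure_ne_top_of_subset hA (by simp)

/-- The measure of the set where the step function of `x` differs from `u`. -/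
noncomputable def stepDist (u : ℝ → H) (x : SSet.toTop.obj (cover hT v χ)) : ℝ :=
  volume.real {s ∈ Set.Ico (0 : ℝ) 1 | stepFunction hT v χ x s ≠ u s}

/-- New disagreements with `u` occur only between old and new division points. Only monotonicity and
subadditivity of the measure are used, so `u` may be arbitrary. -/
theorem stepDist_charMap_le (u : ℝ → H) {n : ℕ} (p : Splx (cover hT v χ) n)
    (z w : stdSimplex ℝ (Fin (n + 1))) :
    stepDist hT v χ u (charMap (cover hT v χ) p z) ≤
      stepDist hT v χ u (charMap (cover hT v χ) p w) +
        ∑ i, |∑ k ∈ Finset.Iio i, z k - ∑ k ∈ Finset.Iio i, w k| := by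
  unfold stepDist
  set A := {s ∈ Set.Ico (0 : ℝ) 1 |
    stepFunction hT v χ (charMap (cover hT v χ) p w) s ≠ u s}
  set B := ⋃ i, Set.uIcc (∑ k ∈ Finset.Iio i, z k) (∑ k ∈ Finset.Iio i, w k)
  have hAt : volume A ≠ ⊤ := measure_ne_top_of_subset_Ico fun s hs => hs.1
  have hBt : volume B ≠ ⊤ := by
    refine ne_top_of_le_ne_top ?_ (measure_iUnion_fintype_le volume _)
    exact (ENNReal.sum_lt_top.2 fun i _ => by
      rw [Real.volume_interval]; exact ENNReal.ofReal_lt_top).ne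
  calc _ ≤ volume.real (A ∪ B) := by
        refine measureReal_mono ?_ (measure_union_lt_top hAt.lt_top hBt.lt_top).ne
        rintro s ⟨hs, hne⟩
        by_contra! hs'
        refine hs' (Or.inl ⟨hs, ?_⟩)
        rw [stepFunction_charMap] at hne ⊢
        rw [simplexStep, if_pos hs] at hne ⊢
        rwa [← stepIndex_eq_of_forall (z := z) fun i hi => hs' (Or.inr (Set.mem_iUnion.2 ⟨i, hi⟩))]
    _ ≤ volume.real A + volume.real B := measureReal_union_le _ _
    _ ≤ _ := by
        gcongr
        refine (measureReal_iUnion_fintype_le _).trans (Finset.sum_le_sum fun i _ => ?_)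
        rw [measureReal_def, Real.volume_interval, ENNReal.toReal_ofReal (abs_nonneg _), abs_sub_comm]

theorem continuous_stepDist (u : ℝ → H) : Continuous (stepDist hT v χ u) := by
  refine continuous_of_charMap fun n p => continuous_iff_continuousAt.2 fun w => ?_
  rw [ContinuousAt, tendsto_iff_dist_tendsto_zero]
  have hc : Continuous fun z : stdSimplex ℝ (Fin (n + 1)) =>
      ∑ i, |∑ k ∈ Finset.Iio i, z k - ∑ k ∈ Finset.Iio i, w k| := by
    have : ∀ k, Continuous fun z : stdSimplex ℝ (Fin (n + 1)) => z k := fun k =>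
      (continuous_apply k).comp continuous_subtype_val
    fun_prop
  have h0 := hc.tendsto w
  simp only [sub_self, abs_zero, Finset.sum_const_zero] at h0
  refine squeeze_zero (fun _ => dist_nonneg) (fun z => ?_) h0
  rw [Real.dist_eq, abs_le]
  have h1 := stepDist_charMap_le hT v χ u p z w
  have h2 := stepDist_charMap_le hT v χ u p w z
  simp_rw [abs_sub_comm (∑ k ∈ Finset.Iio _, w k)] at h2
  constructor <;> linarith

theorem surjective_projTop : Function.Surjective (projTop hT v χ) := by
  intro x
  obtain ⟨n, σ, z, rfl⟩ := exists_charMap_eq x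
  exact ⟨charMap (cover hT v χ) (coverMk hT v χ 1 σ) z, projTop_charMap hT v χ _ z⟩

theorem projTop_smul (h : H) (x : SSet.toTop.obj (cover hT v χ)) :
    projTop hT v χ (h • x) = projTop hT v χ x := by
  obtain ⟨n, p, z, rfl⟩ := exists_charMap_eq x
  rw [smul_charMap, projTop_charMap, projTop_charMap]
  rfl

theorem charMap_mem_orbit {n : ℕ} (p q : Splx (cover hT v χ) n) (h : coverSnd p = coverSnd q)
    (z : stdSimplex ℝ (Fin (n + 1))) :
    charMap (cover hT v χ) p z ∈ MulAction.orbit H (charMap (cover hT v χ) q z) := by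
  refine ⟨coverFst p * (coverFst q)⁻¹, ?_⟩
  change (coverFst p * (coverFst q)⁻¹) • charMap (cover hT v χ) q z = _
  rw [smul_charMap, inv_mul_cancel_right, ← h]
  rfl

/-- The orbit of a lift of `(σ, z)` does not depend on the lift, hence is natural in `(σ, z)` and is
a function of the point of `|X|` alone. -/
theorem mem_orbit_of_projTop_eq {x y : SSet.toTop.obj (cover hT v χ)}
    (h : projTop hT v χ x = projTop hT v χ y) : x ∈ MulAction.orbit H y := by
  obtain ⟨m, p, z, rfl⟩ := exists_charMap_eq x
  obtain ⟨n, q, w, rfl⟩ := exists_charMap_eq y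
  rw [projTop_charMap, projTop_charMap] at h
  have key := eq_of_charMap_eq (X := X)
    (fun n σ z => MulAction.orbit H (charMap (cover hT v χ) (coverMk hT v χ 1 σ) z))
    (fun m n f σ z => by
      rw [← charMap_map]
      exact MulAction.orbit_eq_iff.2 (charMap_mem_orbit hT v χ (coverMk hT v χ 1 (X.map f.op σ))
        ((cover hT v χ).map f.op (coverMk hT v χ 1 σ)) rfl z)) h
  have h1 := MulAction.orbit_eq_iff.2 (charMap_mem_orbit hT v χ p (coverMk hT v χ 1 (coverSnd p)) rfl z)
  have h2 := MulAction.orbit_eq_iff.2 (charMap_mem_orbit hT v χ q (coverMk hT v χ 1 (coverSnd q)) rfl w)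
  exact MulAction.orbit_eq_iff.1 ((h1.trans key).trans h2.symm)

theorem isQuotientMap_projTop : Topology.IsQuotientMap (projTop hT v χ) := by
  refine ⟨.of_isOpen_preimage_iff_isOpen fun U => ⟨fun h => isOpen_of_charMap fun n σ => ?_,
    fun h => h.preimage (projTop hT v χ).continuous⟩, surjective_projTop hT v χ⟩
  convert! h.preimage (charMap (cover hT v χ) (coverMk hT v χ 1 σ)).continuous using 1
  ext z
  change _ ↔ projTop hT v χ _ ∈ U
  rw [projTop_charMap]
  rfl

theorem isQuotientCoveringMap_projTop : IsQuotientCoveringMap (projTop hT v χ) H where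
  toIsQuotientMap := isQuotientMap_projTop hT v χ
  toContinuousConstSMul := inferInstance
  apply_eq_iff_mem_orbit {x y} :=
    ⟨mem_orbit_of_projTop_eq hT v χ, by rintro ⟨h, rfl⟩; exact projTop_smul hT v χ h y⟩
  disjoint x := by
    have hx : stepDist hT v χ (stepFunction hT v χ x) x = 0 := by simp [stepDist]
    -- The radius `1/2` is what makes two disagreement sets too small to cover `[0, 1)`.
    refine ⟨{y | stepDist hT v χ (stepFunction hT v χ x) y < 1 / 2},
      (isOpen_lt (continuous_stepDist hT v χ _) continuous_const).mem_nhds (by simp [hx]), ?_⟩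
    rintro h ⟨_, ⟨y, hy, rfl⟩, hy'⟩
    by_contra hne
    simp only [Set.mem_ofPred_eq] at hy hy'
    unfold stepDist at hy hy'
    have h1 : volume.real (Set.Ico (0 : ℝ) 1) = 1 := by simp
    have h2 := (measureReal_mono (μ := volume) (s₁ := Set.Ico (0 : ℝ) 1) (fun s hs => ?_)
      (measure_ne_top_of_subset_Ico (Set.union_subset (fun s hs => hs.1) (fun s hs => hs.1)))).trans
      (measureReal_union_le {s ∈ Set.Ico (0 : ℝ) 1 |
        stepFunction hT v χ y s ≠ stepFunction hT v χ x s} {s ∈ Set.Ico (0 : ℝ) 1 |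
        stepFunction hT v χ (h • y) s ≠ stepFunction hT v χ x s})
    · linarith
    · by_contra! hs'
      have ha : stepFunction hT v χ y s = stepFunction hT v χ x s := by
        by_contra h; exact hs' (Or.inl ⟨hs, h⟩)
      have hb : stepFunction hT v χ (h • y) s = stepFunction hT v χ x s := by
        by_contra h; exact hs' (Or.inr ⟨hs, h⟩)
      rw [stepFunction_smul hT v χ h y hs, ha] at hb
      exact hne (mul_eq_right.1 hb)

end Covering

/-! ### Classes of paths closed under the groupoid operations. -/

section PathClass

open unitInterval

/-- A class of paths in `Y` that is closed under homotopy, concatenation and reversal and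
contains the constant paths. -/
structure PathClass (Y : Type*) [TopologicalSpace Y] where
  Mem : ∀ {x y : Y}, Path x y → Prop
  of_homotopic : ∀ {x y : Y} {γ δ : Path x y}, γ.Homotopic δ → Mem γ → Mem δ
  refl : ∀ x : Y, Mem (Path.refl x)
  symm : ∀ {x y : Y} {γ : Path x y}, Mem γ → Mem γ.symm
  trans : ∀ {x y z : Y} {γ : Path x y} {δ : Path y z}, Mem γ → Mem δ → Mem (γ.trans δ)

namespace PathClass

variable {Y Z : Type*} [TopologicalSpace Y] [TopologicalSpace Z] (W : PathClass Y)

theorem mem_cast {x y x' y' : Y} (γ : Path x y) (hx : x' = x) (hy : y' = y) :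
    W.Mem (γ.cast hx hy) ↔ W.Mem γ := by
  subst hx hy
  rfl

theorem mem_of_eq {x y x' y' : Y} {γ : Path x y} {δ : Path x' y'} (h : ∀ t, γ t = δ t)
    (hγ : W.Mem γ) : W.Mem δ := by
  obtain rfl : x = x' := by simpa using h 0
  obtain rfl : y = y' := by simpa using h 1
  obtain rfl : γ = δ := Path.ext (funext h)
  exact hγ

/-- The class of paths whose image under `f` is in a given class. -/
def comap (f : C(Z, Y)) : PathClass Z where
  Mem γ := W.Mem (γ.map f.continuous)
  of_homotopic h h' := W.of_homotopic (h.map f) h'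
  refl x := W.refl (f x)
  symm h := W.symm h
  trans {x y z γ δ} h h' := by
    rw [Path.map_trans]
    exact W.trans h h'

/-- Membership of the initial piece of `γ` up to time `t` is locally constant in `t`, and the unit
interval is connected; at time `0` the piece is a constant path. -/
theorem mem_of_locally (h : ∀ x : Y, ∃ U ∈ nhds x, ∀ (a b : Y) (γ : Path a b),
    (∀ t, γ t ∈ U) → W.Mem γ) {x y : Y} (γ : Path x y) : W.Mem γ := by
  have hloc : IsLocallyConstant fun t => W.Mem (γ.subpath 0 t) := by
    rw [IsLocallyConstant.iff_eventually_eq]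
    intro t
    obtain ⟨U, hU, hUW⟩ := h (γ t)
    obtain ⟨ε, hε, hball⟩ := Metric.mem_nhds_iff.1 (γ.continuous.continuousAt hU)
    have hord : (Metric.ball t ε).OrdConnected := by
      have : Metric.ball t ε = Subtype.val ⁻¹' Metric.ball (t : ℝ) ε := rfl
      rw [this, Real.ball_eq_Ioo]
      exact Set.ordConnected_Ioo.preimage_mono fun _ _ h => h
    have key : ∀ a ∈ Metric.ball t ε, ∀ b ∈ Metric.ball t ε,
        W.Mem (γ.subpath 0 a) → W.Mem (γ.subpath 0 b) := by
      intro a ha b hb hm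
      have hab : W.Mem (γ.subpath a b) := by
        refine hUW _ _ _ fun s => ?_
        have hs : γ.subpath a b s ∈ Set.range (γ.subpath a b) := ⟨s, rfl⟩
        rw [Path.range_subpath] at hs
        obtain ⟨r, hr, hrs⟩ := hs
        rw [← hrs]
        exact hball (hord.uIcc_subset ha hb hr)
      exact W.of_homotopic ⟨Path.Homotopy.subpathTransSubpath γ 0 a b⟩ (W.trans hm hab)
    filter_upwards [Metric.ball_mem_nhds t hε] with s hs
    exact propext ⟨key s hs t (Metric.mem_ball_self hε), key t (Metric.mem_ball_self hε) s hs⟩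
  have h01 := hloc.apply_eq_of_preconnectedSpace 0 1
  have h0 : W.Mem (γ.subpath 0 0) := by
    rw [Path.subpath_self]
    exact W.refl _
  have h1 : W.Mem (γ.subpath 0 1) := h01 ▸ h0
  rw [Path.subpath_zero_one] at h1
  exact (W.mem_cast γ γ.source γ.target).1 h1

theorem mem_of_trans_left {x y z : Y} {γ : Path x y} {δ : Path y z} (hδ : W.Mem δ)
    (h : W.Mem (γ.trans δ)) : W.Mem γ := by
  refine W.of_homotopic ?_ (W.trans h (W.symm hδ))
  rw [← Path.Homotopic.Quotient.eq]
  simp only [Path.Homotopic.Quotient.mk_trans, Path.Homotopic.Quotient.mk_symm]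
  rw [Path.Homotopic.Quotient.trans_assoc, Path.Homotopic.Quotient.trans_symm,
    Path.Homotopic.Quotient.trans_refl]

/-- If a homotopy with tracks in `W` deforms a path into a path in `W`, then the path is
in `W`. -/
theorem mem_of_homotopy {g : C(Y, Y)} (K : (ContinuousMap.id Y).Homotopy g)
    (hK : ∀ y, W.Mem (K.evalAt y)) {x y : Y} (γ : Path x y)
    (hγ : W.Mem (γ.map g.continuous)) : W.Mem γ := by
  have h1 := W.of_homotopic (Path.Homotopic.map_trans_evalAt K γ).symm (W.trans (hK x) hγ)
  exact W.mem_of_trans_left (hK y) h1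

end PathClass

end PathClass

/-! ### Interiors of faces of a simplex. -/

section Support

open Finset

theorem stdSimplex_map_apply {m n : ℕ} (f : Fin (m + 1) → Fin (n + 1))
    (z : stdSimplex ℝ (Fin (m + 1))) (j : Fin (n + 1)) :
    stdSimplex.map f z j = ∑ k with f k = j, z k := by
  have := sum_stdSimplex_map f z {j}
  simpa using this

theorem stdSimplex_map_apply_of_injective {m n : ℕ} {f : Fin (m + 1) → Fin (n + 1)}
    (hf : Function.Injective f) (z : stdSimplex ℝ (Fin (m + 1))) (i : Fin (m + 1)) :
    stdSimplex.map f z (f i) = z i := by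
  rw [stdSimplex_map_apply]
  have : ({k | f k = f i} : Finset _) = {i} := by ext k; simp [hf.eq_iff]
  rw [this, sum_singleton]

theorem stdSimplex_map_injective {m n : ℕ} {f : Fin (m + 1) → Fin (n + 1)}
    (hf : Function.Injective f) :
    Function.Injective (stdSimplex.map f : stdSimplex ℝ (Fin (m + 1)) → _) := by
  intro z w h
  ext i
  rw [← stdSimplex_map_apply_of_injective hf, h, stdSimplex_map_apply_of_injective hf]

theorem stdSimplex_map_pos_iff {m n : ℕ} (f : Fin (m + 1) → Fin (n + 1))
    (z : stdSimplex ℝ (Fin (m + 1))) (j : Fin (n + 1)) :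
    0 < stdSimplex.map f z j ↔ ∃ i, f i = j ∧ 0 < z i := by
  have hz : ∀ i, 0 ≤ z i := z.2.1
  rw [stdSimplex_map_apply, sum_pos_iff_of_nonneg fun i _ => hz i]
  simp

/-- Every point of a simplex is an interior point of some face. -/
theorem exists_face_pos {m : ℕ} (z : stdSimplex ℝ (Fin (m + 1))) :
    ∃ (k : ℕ) (f : SimplexCategory.mk k ⟶ SimplexCategory.mk m) (w : stdSimplex ℝ (Fin (k + 1))),
      Function.Injective f ∧ (∀ i, 0 < w i) ∧ stdSimplex.map f w = z := by
  set S : Finset (Fin (m + 1)) := univ.filter fun i => 0 < z i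
  have hsum : ∑ i ∈ S, z i = 1 := by
    have h1 : ∑ i, z i = 1 := z.2.2
    rw [← h1]
    refine sum_subset (subset_univ _) fun i _ hi => ?_
    exact le_antisymm (not_lt.1 fun h => hi (mem_filter.2 ⟨mem_univ _, h⟩)) (z.2.1 i)
  have hne : S.card ≠ 0 := by
    intro h
    rw [card_eq_zero] at h
    rw [h] at hsum
    simp at hsum
  obtain ⟨k, hk⟩ := Nat.exists_eq_succ_of_ne_zero hne
  let e := S.orderEmbOfFin hk
  have he : ∀ i, 0 < z (e i) := fun i => (mem_filter.1 (S.orderEmbOfFin_mem hk i)).2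
  refine ⟨k, SimplexCategory.Hom.mk e.toOrderHom, ⟨fun i => z (e i), fun i => z.2.1 _, ?_⟩,
    e.injective, he, ?_⟩
  · rw [← hsum, ← S.map_orderEmbOfFin_univ hk, sum_map]
    rfl
  · ext j
    by_cases hj : j ∈ S
    · obtain ⟨i, rfl⟩ : ∃ i, e i = j := by
        have : j ∈ Set.range e := by rw [S.range_orderEmbOfFin hk]; exact hj
        exact this
      exact stdSimplex_map_apply_of_injective e.injective _ i
    · have h0 : z j = 0 :=
        le_antisymm (not_lt.1 fun h => hj (mem_filter.2 ⟨mem_univ _, h⟩)) (z.2.1 j)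
      rw [h0]
      refine le_antisymm (not_lt.1 fun h => ?_) ((stdSimplex.map _ _).2.1 j)
      obtain ⟨i, rfl, -⟩ := (stdSimplex_map_pos_iff _ _ _).1 h
      exact hj (S.orderEmbOfFin_mem hk i)

/-- Two representations of a point of a simplex, the first of them on an open face. -/
theorem exists_surjective_of_map_eq {m k l : ℕ}
    (e : SimplexCategory.mk k ⟶ SimplexCategory.mk m) (he : Function.Injective e)
    (z : stdSimplex ℝ (Fin (k + 1))) (hz : ∀ i, 0 < z i)
    (f : SimplexCategory.mk l ⟶ SimplexCategory.mk m)
    (w : stdSimplex ℝ (Fin (l + 1))) (hw : ∀ i, 0 < w i)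
    (h : stdSimplex.map e z = stdSimplex.map f w) :
    ∃ q : SimplexCategory.mk l ⟶ SimplexCategory.mk k, Function.Surjective q ∧ q ≫ e = f ∧
      stdSimplex.map q w = z := by
  have hr : ∀ i : Fin (l + 1), ∃ j : Fin (k + 1), e j = f i := by
    intro i
    have : 0 < stdSimplex.map f w (f i) := (stdSimplex_map_pos_iff _ _ _).2 ⟨i, rfl, hw i⟩
    rw [← h] at this
    obtain ⟨j, hj, -⟩ := (stdSimplex_map_pos_iff _ _ _).1 this
    exact ⟨j, hj⟩
  choose q hq using hr
  have hes : StrictMono e := e.toOrderHom.monotone.strictMono_of_injective he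
  have hqm : Monotone q := fun a b hab => by
    rw [← hes.le_iff_le, hq, hq]
    exact f.toOrderHom.monotone hab
  have hqe : SimplexCategory.Hom.mk ⟨q, hqm⟩ ≫ e = f := by
    ext i : 3
    exact hq i
  refine ⟨SimplexCategory.Hom.mk ⟨q, hqm⟩, fun j => ?_, hqe, ?_⟩
  · have : 0 < stdSimplex.map e z (e j) := (stdSimplex_map_pos_iff _ _ _).2 ⟨j, rfl, hz j⟩
    rw [h] at this
    obtain ⟨i, hi, -⟩ := (stdSimplex_map_pos_iff _ _ _).1 this
    exact ⟨i, he ((hq i).trans hi)⟩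
  · apply stdSimplex_map_injective he
    rw [h, ← hqe, stdSimplex.map_comp_apply]
    rfl

end Support

/-! ### The realization of a subcomplex is a closed subspace. -/

section Subcomplex

variable {X : SSet.{u}} (A : X.Subcomplex)

theorem Subcomplex_map_mem {m n : ℕ} (f : SimplexCategory.mk m ⟶ SimplexCategory.mk n)
    {σ : Splx X n} (hσ : σ ∈ A.obj _) : X.map f.op σ ∈ A.obj (op (SimplexCategory.mk m)) :=
  A.map f.op hσ

/-- Surjections in the simplex category split, so `σ` is recovered from its degeneracy by a face
operator. -/
theorem mem_of_map_mem_of_surjective {m n : ℕ} {f : SimplexCategory.mk m ⟶ SimplexCategory.mk n}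
    (hf : Function.Surjective f) {σ : Splx X n}
    (hσ : X.map f.op σ ∈ A.obj (op (SimplexCategory.mk m))) :
    σ ∈ A.obj (op (SimplexCategory.mk n)) := by
  have : Epi f := SimplexCategory.epi_iff_surjective.2 hf
  have : IsSplitEpi f := isSplitEpi_of_epi f
  have h := Subcomplex_map_mem A (section_ f) hσ
  rw [← CategoryTheory.comp_apply, ← X.map_comp, ← op_comp, IsSplitEpi.id, op_id, X.map_id] at h
  exact h

variable {A} in
/-- A simplex of `X` that lies in `A`, as a simplex of `A`. -/
def subMk {n : ℕ} (σ : Splx X n) (h : σ ∈ A.obj (op (SimplexCategory.mk n))) :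
    Splx (A : SSet.{u}) n := ⟨σ, h⟩

variable {A} in
/-- A simplex of `A`, as a simplex of `X`. -/
def subVal {n : ℕ} (σ : Splx (A : SSet.{u}) n) : Splx X n := Subtype.val σ

theorem subVal_mem {n : ℕ} (σ : Splx (A : SSet.{u}) n) :
    subVal σ ∈ A.obj (op (SimplexCategory.mk n)) := Subtype.prop σ

/-- The inclusion `|A| → |X|` of a subcomplex. -/
noncomputable def subcomplexMap : C(SSet.toTop.obj (A : SSet.{u}), SSet.toTop.obj X) :=
  (SSet.toTop.map A.ι).hom

theorem subcomplexMap_charMap {n : ℕ} (σ : Splx (A : SSet.{u}) n)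
    (z : stdSimplex ℝ (Fin (n + 1))) :
    subcomplexMap A (charMap (A : SSet.{u}) σ z) = charMap X (subVal σ) z :=
  charMap_natural A.ι σ z

theorem subcomplexMap_charMap_subMk {n : ℕ} (σ : Splx X n)
    (h : σ ∈ A.obj (op (SimplexCategory.mk n))) (z : stdSimplex ℝ (Fin (n + 1))) :
    subcomplexMap A (charMap (A : SSet.{u}) (subMk σ h) z) = charMap X σ z :=
  subcomplexMap_charMap A _ z

theorem charMap_subMk_map {m n : ℕ} (f : SimplexCategory.mk m ⟶ SimplexCategory.mk n)
    (σ : Splx X n) (h : σ ∈ A.obj (op (SimplexCategory.mk n))) (τ : Splx X m)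
    (hτ : τ = X.map f.op σ) (h' : τ ∈ A.obj (op (SimplexCategory.mk m))) z :
    charMap (A : SSet.{u}) (subMk τ h') z =
      charMap (A : SSet.{u}) (subMk σ h) (stdSimplex.map f z) := by
  subst hτ
  exact charMap_map (A : SSet.{u}) f (subMk σ h) z

open Classical in
/-- The partial inverse of `|A| → |X|` on a face of a simplex of `X`. -/
noncomputable def partialRetractFace {n k : ℕ} (σ : Splx X n)
    (e : SimplexCategory.mk k ⟶ SimplexCategory.mk n) (w : stdSimplex ℝ (Fin (k + 1))) :
    Option (SSet.toTop.obj (A : SSet.{u})) :=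
  if h : X.map e.op σ ∈ A.obj (op (SimplexCategory.mk k)) then
    some (charMap (A : SSet.{u}) (subMk _ h) w) else none

/-- The two representations of an interior point differ by a surjection `q`, and a simplex lies in
`A` exactly when its pullback along `q` does. Hence the choice of face in `partialRetract` is
immaterial. -/
theorem partialRetractFace_eq {n k l : ℕ} (σ : Splx X n)
    (e : SimplexCategory.mk k ⟶ SimplexCategory.mk n) (he : Function.Injective e)
    (w : stdSimplex ℝ (Fin (k + 1))) (hw : ∀ i, 0 < w i)
    (f : SimplexCategory.mk l ⟶ SimplexCategory.mk n)
    (z : stdSimplex ℝ (Fin (l + 1))) (hz : ∀ i, 0 < z i)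
    (h : stdSimplex.map e w = stdSimplex.map f z) :
    partialRetractFace A σ e w = partialRetractFace A σ f z := by
  obtain ⟨q, hq, rfl, rfl⟩ := exists_surjective_of_map_eq e he w hw f z hz h
  have hmap : X.map (q ≫ e).op σ = X.map q.op (X.map e.op σ) := by
    rw [op_comp, X.map_comp]
    rfl
  unfold partialRetractFace
  by_cases h : X.map e.op σ ∈ A.obj (op (SimplexCategory.mk k))
  · have h' : X.map (q ≫ e).op σ ∈ A.obj (op (SimplexCategory.mk l)) := by
      rw [hmap]; exact Subcomplex_map_mem A q h
    rw [dif_pos h, dif_pos h', charMap_subMk_map A q _ h _ hmap h']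
  · rw [dif_neg h, dif_neg]
    rw [hmap]
    exact fun h' => h (mem_of_map_mem_of_surjective A hq h')

/-- The partial inverse of `|A| → |X|` on a simplex of `X`. -/
noncomputable def partialRetract (n : ℕ) (σ : Splx X n) (z : stdSimplex ℝ (Fin (n + 1))) :
    Option (SSet.toTop.obj (A : SSet.{u})) :=
  partialRetractFace A σ (exists_face_pos z).choose_spec.choose
    (exists_face_pos z).choose_spec.choose_spec.choose

theorem partialRetract_map_eq {n k : ℕ} (σ : Splx X n)
    (e : SimplexCategory.mk k ⟶ SimplexCategory.mk n) (w : stdSimplex ℝ (Fin (k + 1)))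
    (hw : ∀ i, 0 < w i) :
    partialRetract A n σ (stdSimplex.map e w) = partialRetractFace A σ e w := by
  obtain ⟨he', hw', hz'⟩ :=
    (exists_face_pos (stdSimplex.map e w)).choose_spec.choose_spec.choose_spec
  exact partialRetractFace_eq A σ _ he' _ hw' e w hw hz'

theorem partialRetract_natural (m n : ℕ) (f : SimplexCategory.mk m ⟶ SimplexCategory.mk n)
    (σ : Splx X n) (z : stdSimplex ℝ (Fin (m + 1))) :
    partialRetract A m (X.map f.op σ) z = partialRetract A n σ (stdSimplex.map f z) := by
  obtain ⟨k, e, w, -, hw, rfl⟩ := exists_face_pos z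
  have : stdSimplex.map f (stdSimplex.map e w) = stdSimplex.map (e ≫ f) w := by
    rw [stdSimplex.map_comp_apply]
    rfl
  rw [this, partialRetract_map_eq A _ _ _ hw, partialRetract_map_eq A _ _ _ hw]
  unfold partialRetractFace
  rw [op_comp, X.map_comp]
  rfl

theorem partialRetract_of_mem {n : ℕ} (σ : Splx (A : SSet.{u}) n)
    (z : stdSimplex ℝ (Fin (n + 1))) :
    partialRetract A n (subVal σ) z = some (charMap (A : SSet.{u}) σ z) := by
  obtain ⟨k, e, w, -, hw, rfl⟩ := exists_face_pos z
  rw [partialRetract_map_eq A _ _ _ hw, partialRetractFace,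
    dif_pos (Subcomplex_map_mem A e (subVal_mem A σ)), ← charMap_map]
  rfl

/-- Injectivity comes from the partial inverse `|X| → Option |A|`, which needs no continuity. For
closedness, the image of a closed set meets each simplex in a finite union of compact sets, one for
each operator from dimension at most `n` that carries the simplex into `A`. -/
theorem isClosedEmbedding_subcomplexMap :
    Topology.IsClosedEmbedding (subcomplexMap A) := by
  obtain ⟨ρ, hρ⟩ := exists_function_charMap (partialRetract A) (partialRetract_natural A)
  have hρι : ∀ x, ρ (subcomplexMap A x) = some x := by
    intro x
    obtain ⟨n, σ, z, rfl⟩ := exists_charMap_eq x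
    rw [subcomplexMap_charMap, hρ, partialRetract_of_mem]
  refine .of_continuous_injective_isClosedMap (subcomplexMap A).continuous (fun x y h => ?_)
    fun C hC => isClosed_of_charMap fun n σ => ?_
  · have := congrArg ρ h
    rw [hρι, hρι] at this
    exact Option.some_injective _ this
  · have : charMap X σ ⁻¹' (subcomplexMap A '' C) =
        ⋃ k : Fin (n + 1), ⋃ f : SimplexCategory.mk k ⟶ SimplexCategory.mk n,
          ⋃ h : X.map f.op σ ∈ A.obj (op (SimplexCategory.mk k)), stdSimplex.map f ''
            (charMap (A : SSet.{u}) (subMk (X.map f.op σ) h) ⁻¹' C) := by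
      ext z
      simp only [Set.mem_iUnion]
      constructor
      · rintro ⟨c, hc, hcz⟩
        have h1 : ρ (charMap X σ z) = some c := by rw [← hcz, hρι]
        rw [hρ] at h1
        obtain ⟨k, e, w, he, hw, rfl⟩ := exists_face_pos z
        -- Injectivity of `e` bounds its source dimension; this is what keeps the union finite.
        have hk : k ≤ n := by
          have : Mono e := SimplexCategory.mono_iff_injective.2 he
          exact SimplexCategory.len_le_of_mono e
        rw [partialRetract_map_eq A _ _ _ hw, partialRetractFace] at h1
        split_ifs at h1 with h
        refine ⟨⟨k, Nat.lt_succ_of_le hk⟩, e, h, w, ?_, rfl⟩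
        rw [Set.mem_preimage, Option.some_injective _ h1]
        exact hc
      · rintro ⟨k, f, h, w, hw, rfl⟩
        refine ⟨_, hw, ?_⟩
        rw [subcomplexMap_charMap_subMk, charMap_map]
    rw [this]
    refine isClosed_iUnion_of_finite fun k => isClosed_iUnion_of_finite fun f =>
      isClosed_iUnion_of_finite fun h => ?_
    exact ((hC.preimage (charMap _ _).continuous).isCompact.image
      (stdSimplex.continuous_map f)).isClosed

end Subcomplex

/-! ### Attaching the top-dimensional cells to the lower skeleton. -/

section Skeleton

variable (X : SSet.{u}) (d : ℕ)

/-- The subcomplex of `X` generated by the simplices of dimension `< d`. -/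
abbrev skel : X.Subcomplex := X.skeleton d

instance hasDimensionLT_skel : SSet.HasDimensionLT (skel X d : SSet.{u}) d where
  degenerate_eq_top n hn := by
    rw [Set.top_eq_univ, Set.eq_univ_iff_forall]
    intro σ
    by_contra h
    have h1 : σ ∈ (skel X d : SSet.{u}).nonDegenerate n := h
    replace h1 := (SSet.Subcomplex.mem_nonDegenerate_iff (A := skel X d) σ).1 h1
    have := (X.mem_skeleton_obj_iff_of_nonDegenerate ⟨σ.1, h1⟩ d).1 σ.2
    omega

variable {X d}

theorem mem_skel_or_exists [X.HasDimensionLT (d + 1)] {m : ℕ} (τ : Splx X m) :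
    τ ∈ (skel X d).obj (op (SimplexCategory.mk m)) ∨ ∃ (c : X.nonDegenerate d)
      (f : SimplexCategory.mk m ⟶ SimplexCategory.mk d), Epi f ∧ τ = X.map f.op c.1 := by
  obtain ⟨k, f, hf, y, rfl⟩ := X.exists_nonDegenerate τ
  rcases lt_trichotomy k d with h | rfl | h
  · exact Or.inl (Subcomplex_map_mem _ f (X.mem_skeleton y.1 h))
  · exact Or.inr ⟨y, f, hf, rfl⟩
  · exfalso
    have h1 := SSet.HasDimensionLT.degenerate_eq_top (X := X) (d := d + 1) k h
    have h2 := y.2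
    rw [SSet.mem_nonDegenerate_iff_notMem_degenerate, h1] at h2
    exact h2 trivial

theorem nonDegenerate_notMem_skel (c : X.nonDegenerate d) :
    c.1 ∉ (skel X d).obj (op (SimplexCategory.mk d)) := by
  intro h
  exact lt_irrefl d ((X.mem_skeleton_obj_iff_of_nonDegenerate c d).1 h)

theorem not_surjective_of_map_mem_skel {c : X.nonDegenerate d} {m : ℕ}
    {f : SimplexCategory.mk m ⟶ SimplexCategory.mk d}
    (h : X.map f.op c.1 ∈ (skel X d).obj (op (SimplexCategory.mk m))) :
    ¬ Function.Surjective f := fun hf =>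
  nonDegenerate_notMem_skel c (mem_of_map_mem_of_surjective _ hf h)

theorem map_mem_skel_of_not_surjective (σ : Splx X d) {m : ℕ}
    {f : SimplexCategory.mk m ⟶ SimplexCategory.mk d} (hf : ¬ Function.Surjective f) :
    X.map f.op σ ∈ (skel X d).obj (op (SimplexCategory.mk m)) := by
  cases d with
  | zero =>
    exact absurd (fun j => ⟨0, Subsingleton.elim (α := Fin 1) _ _⟩) hf
  | succ d =>
    obtain ⟨i, g, rfl⟩ := SimplexCategory.eq_comp_δ_of_not_surjective f hf
    rw [op_comp, X.map_comp]
    exact Subcomplex_map_mem _ g (X.mem_skeleton (X.map (SimplexCategory.δ i).op σ)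
      (Nat.lt_succ_self d))

theorem exists_map_eq_zero {m : ℕ} {f : SimplexCategory.mk m ⟶ SimplexCategory.mk d}
    (hf : ¬ Function.Surjective f) (z : stdSimplex ℝ (Fin (m + 1))) :
    ∃ j, stdSimplex.map f z j = 0 := by
  have ⟨j, hj⟩ := not_forall.1 hf
  refine ⟨j, le_antisymm (not_lt.1 fun h => ?_) ((stdSimplex.map f z).2.1 j)⟩
  obtain ⟨i, hi, -⟩ := (stdSimplex_map_pos_iff _ _ _).1 h
  exact hj ⟨i, hi⟩

theorem charMap_mem_range_of_eq_zero (σ : Splx X d) {z : stdSimplex ℝ (Fin (d + 1))}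
    {j : Fin (d + 1)} (hj : z j = 0) : charMap X σ z ∈ Set.range (subcomplexMap (skel X d)) := by
  obtain ⟨k, e, w, -, hw, rfl⟩ := exists_face_pos z
  have he : ¬ Function.Surjective e := fun he => by
    obtain ⟨i, hi⟩ := he j
    have := (stdSimplex_map_pos_iff e w j).2 ⟨i, hi, hw i⟩
    rw [hj] at this
    exact lt_irrefl 0 this
  refine ⟨charMap _ (subMk _ (map_mem_skel_of_not_surjective σ he)) w, ?_⟩
  rw [subcomplexMap_charMap_subMk, charMap_map]

theorem exists_skel_or_cell [X.HasDimensionLT (d + 1)] (x : SSet.toTop.obj X) :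
    (∃ a, subcomplexMap (skel X d) a = x) ∨
      ∃ (c : X.nonDegenerate d) (z : stdSimplex ℝ (Fin (d + 1))), charMap X c.1 z = x := by
  obtain ⟨m, τ, z, rfl⟩ := exists_charMap_eq x
  rcases mem_skel_or_exists (d := d) τ with h | ⟨c, f, -, rfl⟩
  · exact Or.inl ⟨_, subcomplexMap_charMap_subMk _ τ h z⟩
  · refine Or.inr ⟨c, stdSimplex.map f z, ?_⟩
    rw [charMap_map]

theorem continuous_of_skel [X.HasDimensionLT (d + 1)] {Y : Type*} [TopologicalSpace Y]
    {G : SSet.toTop.obj X → Y} (h : Continuous fun a => G (subcomplexMap (skel X d) a))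
    (h' : ∀ c : X.nonDegenerate d, Continuous fun z => G (charMap X c.1 z)) : Continuous G := by
  refine continuous_of_charMap fun m τ => ?_
  rcases mem_skel_or_exists (d := d) τ with hτ | ⟨c, f, -, rfl⟩
  · simp_rw [← subcomplexMap_charMap_subMk _ τ hτ]
    exact h.comp (charMap _ _).continuous
  · simp_rw [charMap_map]
    exact (h' c).comp (stdSimplex.continuous_map f)

/-- A function on `|X|` can be defined on a skeleton and on the cells attached to it. -/
theorem exists_function_skel [X.HasDimensionLT (d + 1)] {Y : Sort*}
    (gA : SSet.toTop.obj (skel X d : SSet.{u}) → Y)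
    (gc : X.nonDegenerate d → stdSimplex ℝ (Fin (d + 1)) → Y)
    (hg : ∀ (c : X.nonDegenerate d) (z : stdSimplex ℝ (Fin (d + 1))) (a), (∃ j, z j = 0) →
      subcomplexMap (skel X d) a = charMap X c.1 z → gA a = gc c z) :
    ∃ G : SSet.toTop.obj X → Y, (∀ a, G (subcomplexMap (skel X d) a) = gA a) ∧
      ∀ (c : X.nonDegenerate d) z, G (charMap X c.1 z) = gc c z := by
  classical
  have hex : ∀ m (τ : Splx X m), ∃ g : stdSimplex ℝ (Fin (m + 1)) → Y,
      (∀ h : τ ∈ (skel X d).obj (op (SimplexCategory.mk m)),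
        ∀ z, g z = gA (charMap _ (subMk τ h) z)) ∧
      ∀ (c : X.nonDegenerate d) (f : SimplexCategory.mk m ⟶ SimplexCategory.mk d),
        τ = X.map f.op c.1 → ∀ z, g z = gc c (stdSimplex.map f z) := by
    intro m τ
    by_cases h : τ ∈ (skel X d).obj (op (SimplexCategory.mk m))
    · refine ⟨fun z => gA (charMap _ (subMk τ h) z), fun _ _ => rfl, ?_⟩
      rintro c f rfl z
      refine hg _ _ _ (exists_map_eq_zero (not_surjective_of_map_mem_skel h) z) ?_
      rw [subcomplexMap_charMap_subMk, charMap_map]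
    · obtain ⟨c, f, hf, rfl⟩ := (mem_skel_or_exists (d := d) τ).resolve_left h
      refine ⟨fun z => gc c (stdSimplex.map f z), fun h' => absurd h' h, fun c' f' h' z => ?_⟩
      -- Eilenberg–Zilber uniqueness: outside the skeleton the pair of cell and operator is
      -- determined, so the prescription is unambiguous.
      obtain rfl := X.unique_nonDegenerate_simplex _ f c rfl f' c' h'
      obtain rfl := X.unique_nonDegenerate_map _ f c rfl f' c h'
      rfl
  choose g hgA hgc using hex
  obtain ⟨G, hG⟩ := exists_function_charMap g (fun m n f τ z => by
    rcases mem_skel_or_exists (d := d) τ with h | ⟨c, e, -, rfl⟩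
    · rw [hgA _ _ h, hgA _ _ (Subcomplex_map_mem _ f h), charMap_subMk_map _ f _ h _ rfl]
    · rw [hgc _ _ c e rfl, hgc _ _ c (f ≫ e) (by rw [op_comp, X.map_comp]; rfl),
        stdSimplex.map_comp_apply]
      rfl)
  refine ⟨G, fun a => ?_, fun c z => ?_⟩
  · obtain ⟨m, τ, z, rfl⟩ := exists_charMap_eq a
    rw [subcomplexMap_charMap, hG, hgA _ _ (subVal_mem _ τ)]
    rfl
  · rw [hG, hgc _ _ c (𝟙 _) (by rw [op_id, X.map_id]; rfl)]
    congr 1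
    exact stdSimplex.map_id_apply z

end Skeleton

/-! ### Pushing a collar of a simplex onto its boundary. -/

section SimplexGeometry

open Finset unitInterval

variable {d : ℕ}

theorem continuous_stdSimplex_apply (i : Fin (d + 1)) :
    Continuous fun z : stdSimplex ℝ (Fin (d + 1)) => z i :=
  (continuous_apply i).comp continuous_subtype_val

/-- The smallest barycentric coordinate. -/
noncomputable def minCoord (z : stdSimplex ℝ (Fin (d + 1))) : ℝ := univ.inf' univ_nonempty fun i => z i

theorem continuous_minCoord : Continuous (minCoord (d := d)) :=
  Continuous.finset_inf'_apply _ fun i _ => continuous_stdSimplex_apply i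

theorem minCoord_le (z : stdSimplex ℝ (Fin (d + 1))) (i : Fin (d + 1)) : minCoord z ≤ z i :=
  inf'_le _ (mem_univ i)

theorem exists_eq_minCoord (z : stdSimplex ℝ (Fin (d + 1))) : ∃ i, z i = minCoord z := by
  obtain ⟨i, -, hi⟩ := exists_mem_eq_inf' univ_nonempty fun i => z i
  exact ⟨i, hi.symm⟩

theorem minCoord_nonneg (z : stdSimplex ℝ (Fin (d + 1))) : 0 ≤ minCoord z := by
  obtain ⟨i, hi⟩ := exists_eq_minCoord z
  rw [← hi]
  exact z.2.1 i

theorem minCoord_eq_zero {z : stdSimplex ℝ (Fin (d + 1))} (h : ∃ j, z j = 0) :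
    minCoord z = 0 := by
  obtain ⟨j, hj⟩ := h
  exact le_antisymm (hj ▸ minCoord_le z j) (minCoord_nonneg z)

/-- The width of the collar that is pushed to the boundary by `push`. -/
noncomputable def collar (d : ℕ) : ℝ := 1 / (2 * (d + 1))

theorem collar_pos : 0 < collar d := by unfold collar; positivity

/-- The collar width is chosen so that the denominator in `push` stays at least `1/2`, which gives
continuity even where all coordinates are equal. -/
theorem half_le_one_sub (z : stdSimplex ℝ (Fin (d + 1))) :
    1 / 2 ≤ 1 - (d + 1) * min (minCoord z) (collar d) := by
  have h : (d + 1) * min (minCoord z) (collar d) ≤ (d + 1) * collar d := by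
    gcongr
    exact min_le_right _ _
  have h2 : ((d : ℝ) + 1) * collar d = 1 / 2 := by
    unfold collar
    field_simp
  linarith

/-- The map of the simplex to itself that pushes a collar of the boundary to the boundary
and is the identity on the boundary. -/
noncomputable def push (z : stdSimplex ℝ (Fin (d + 1))) : stdSimplex ℝ (Fin (d + 1)) :=
  ⟨fun i => (z i - min (minCoord z) (collar d)) / (1 - (d + 1) * min (minCoord z) (collar d)),
    fun i => div_nonneg (sub_nonneg.2 ((min_le_left _ _).trans (minCoord_le z i)))
      (by linarith [half_le_one_sub z]), by
    have h1 : ∑ i, z i = 1 := z.2.2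
    have h2 := half_le_one_sub z
    rw [← sum_div, sum_sub_distrib, h1, sum_const, card_univ, Fintype.card_fin, nsmul_eq_mul,
      Nat.cast_succ]
    exact div_self (by linarith)⟩

theorem push_apply (z : stdSimplex ℝ (Fin (d + 1))) (i : Fin (d + 1)) : push z i =
    (z i - min (minCoord z) (collar d)) / (1 - (d + 1) * min (minCoord z) (collar d)) := rfl

theorem continuous_push : Continuous (push (d := d)) := by
  refine Continuous.subtype_mk (continuous_pi fun i => ?_) _
  have h1 := continuous_stdSimplex_apply i
  have h2 := continuous_minCoord (d := d)
  have h3 : Continuous fun z : stdSimplex ℝ (Fin (d + 1)) => min (minCoord z) (collar d) :=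
    h2.min continuous_const
  refine Continuous.div (h1.sub h3) (continuous_const.sub (continuous_const.mul h3)) fun z => ?_
  linarith [half_le_one_sub z]

theorem push_of_exists_eq_zero {z : stdSimplex ℝ (Fin (d + 1))} (h : ∃ j, z j = 0) :
    push z = z := by
  ext i
  rw [push_apply, minCoord_eq_zero h, min_eq_left collar_pos.le]
  simp

theorem exists_push_eq_zero {z : stdSimplex ℝ (Fin (d + 1))} (h : minCoord z < collar d) :
    ∃ j, push z j = 0 := by
  obtain ⟨j, hj⟩ := exists_eq_minCoord z
  exact ⟨j, by rw [push_apply, hj, min_eq_left h.le, sub_self, zero_div]⟩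

/-- The straight path from `z` to `push z`. -/
noncomputable def pushPath (z : stdSimplex ℝ (Fin (d + 1))) (t : I) : stdSimplex ℝ (Fin (d + 1)) :=
  ⟨(1 - (t : ℝ)) • z.1 + (t : ℝ) • (push z).1,
    convex_stdSimplex ℝ _ z.2 (push z).2 (one_minus_nonneg t) t.2.1 (by ring)⟩

theorem continuous_pushPath : Continuous fun p : stdSimplex ℝ (Fin (d + 1)) × I =>
    pushPath p.1 p.2 := by
  refine Continuous.subtype_mk ?_ _
  have h1 : Continuous fun p : stdSimplex ℝ (Fin (d + 1)) × I => (p.2 : ℝ) :=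
    continuous_subtype_val.comp continuous_snd
  have h2 : Continuous fun p : stdSimplex ℝ (Fin (d + 1)) × I => p.1.1 :=
    continuous_subtype_val.comp continuous_fst
  have h3 : Continuous fun p : stdSimplex ℝ (Fin (d + 1)) × I => (push p.1).1 :=
    continuous_subtype_val.comp (continuous_push.comp continuous_fst)
  exact ((continuous_const.sub h1).smul h2).add (h1.smul h3)

theorem pushPath_zero (z : stdSimplex ℝ (Fin (d + 1))) : pushPath z 0 = z := by
  apply Subtype.ext
  simp [pushPath]

theorem pushPath_one (z : stdSimplex ℝ (Fin (d + 1))) : pushPath z 1 = push z := by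
  apply Subtype.ext
  simp [pushPath]

theorem pushPath_of_exists_eq_zero {z : stdSimplex ℝ (Fin (d + 1))} (h : ∃ j, z j = 0) (t : I) :
    pushPath z t = z := by
  apply Subtype.ext
  simp only [pushPath, push_of_exists_eq_zero h]
  rw [← add_smul]
  simp

end SimplexGeometry

/-! ### Continuous functions and a homotopy assembled from cells. -/

section CellFunctions

open unitInterval

variable {X : SSet.{u}} {d : ℕ} [X.HasDimensionLT (d + 1)]

variable (X d) in
/-- On a simplicial set of dimension at most `d` there is a continuous function that vanishes on
the `(d - 1)`-skeleton and is the smallest barycentric coordinate on each `d`-cell. -/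
theorem exists_depth : ∃ M : C(SSet.toTop.obj X, ℝ), (∀ a, M (subcomplexMap (skel X d) a) = 0) ∧
    ∀ (c : X.nonDegenerate d) z, M (charMap X c.1 z) = minCoord z := by
  obtain ⟨M, h1, h2⟩ := exists_function_skel (X := X) (d := d) (fun _ => (0 : ℝ))
    (fun _ z => minCoord z) (fun c z a h _ => (minCoord_eq_zero h).symm)
  refine ⟨⟨M, continuous_of_skel (d := d) ?_ fun c => ?_⟩, h1, h2⟩
  · simp_rw [h1]
    exact continuous_const
  · simp_rw [h2]
    exact continuous_minCoord

/-- Rescaled barycentric coordinates on a single `d`-cell, extended by zero. -/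
theorem exists_cellCoord (c : X.nonDegenerate d) :
    ∃ κ : C(SSet.toTop.obj X, Fin (d + 1) → ℝ), (∀ a, κ (subcomplexMap (skel X d) a) = 0) ∧
      (∀ z, κ (charMap X c.1 z) = minCoord z • z.1) ∧
      ∀ (c' : X.nonDegenerate d) z, c' ≠ c → κ (charMap X c'.1 z) = 0 := by
  classical
  obtain ⟨κ, h1, h2⟩ := exists_function_skel (X := X) (d := d) (fun _ => (0 : Fin (d + 1) → ℝ))
    -- The factor `minCoord z` makes the coordinates vanish on the boundary, so they extend by zero.
    -- Since their sum is `minCoord z`, dividing by it recovers `z` in the interior.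
    (fun c' z => if c' = c then minCoord z • z.1 else 0) (fun c z a h _ => by
      rw [minCoord_eq_zero h, zero_smul, ite_self])
  refine ⟨⟨κ, continuous_of_skel (d := d) ?_ fun c' => ?_⟩, h1, fun z => ?_, fun c' z hc => ?_⟩
  · simp_rw [h1]
    exact continuous_const
  · simp_rw [h2]
    have := continuous_minCoord (d := d)
    split_ifs <;> fun_prop
  · exact (h2 c z).trans (if_pos rfl)
  · exact (h2 c' z).trans (if_neg hc)

variable (X d) in
/-- The homotopy that pushes collars in the `d`-cells to the `(d - 1)`-skeleton. -/
theorem exists_collar_homotopy : ∃ (g : C(SSet.toTop.obj X, SSet.toTop.obj X))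
    (K : (ContinuousMap.id (SSet.toTop.obj X)).Homotopy g),
      (∀ a t, K (t, subcomplexMap (skel X d) a) = subcomplexMap (skel X d) a) ∧
      ∀ (c : X.nonDegenerate d) z t, K (t, charMap X c.1 z) = charMap X c.1 (pushPath z t) := by
  -- The homotopy is built as a map from `|X|` into the path space `C(I, |X|)`, so continuity is
  -- tested on cells; currying then avoids any comparison of topologies on `|X| × I`.
  obtain ⟨K, h1, h2⟩ := exists_function_skel (X := X) (d := d)
    (fun a => ContinuousMap.const I (subcomplexMap (skel X d) a))
    (fun c z => (⟨fun t => charMap X c.1 (pushPath z t), (charMap X c.1).continuous.comp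
      (continuous_pushPath.comp (Continuous.prodMk_right z))⟩ : C(I, SSet.toTop.obj X)))
    (fun c z a h h' => by
      ext t
      exact h'.trans (congrArg _ (pushPath_of_exists_eq_zero h t).symm))
  have hK : Continuous K := by
    refine continuous_of_skel (d := d) ?_ fun c => ?_
    · simp_rw [h1]
      exact ContinuousMap.continuous_const'.comp (subcomplexMap (skel X d)).continuous
    · simp_rw [h2]
      refine ContinuousMap.continuous_of_continuous_uncurry _ ?_
      exact (charMap X c.1).continuous.comp continuous_pushPath
  have hu : Continuous fun p : SSet.toTop.obj X × I => K p.1 p.2 :=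
    ContinuousMap.continuous_uncurry_of_continuous ⟨K, hK⟩
  refine ⟨⟨fun x => K x 1, hu.comp (Continuous.prodMk_left 1)⟩,
    { toFun := fun p => K p.2 p.1
      continuous_toFun := hu.comp continuous_swap
      map_zero_left := fun x => ?_
      map_one_left := fun x => rfl }, fun a t => ?_, fun c z t => ?_⟩
  · rcases exists_skel_or_cell (d := d) x with ⟨a, rfl⟩ | ⟨c, z, rfl⟩
    · change K _ 0 = _
      rw [h1]
      rfl
    · change K _ 0 = _
      rw [h2]
      exact congrArg (charMap X c.1) (pushPath_zero z)
  · exact congrArg (fun f : C(I, _) => f t) (h1 a)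
  · exact congrArg (fun f : C(I, _) => f t) (h2 c z)

end CellFunctions

/-! ### Every path is generated by paths in simplices. -/

section Generation

variable {X : SSet.{u}}

/-- The class contains all paths that run in a single simplex of `X`. -/
def PathClass.ContainsSimplices (W : PathClass (SSet.toTop.obj X)) : Prop :=
  ∀ (n : ℕ) (σ : Splx X n) (z w : stdSimplex ℝ (Fin (n + 1))) (p : Path z w),
    W.Mem (p.map (charMap X σ).continuous)

theorem PathClass.ContainsSimplices.comap {W : PathClass (SSet.toTop.obj X)}
    (hW : W.ContainsSimplices) (A : X.Subcomplex) :
    PathClass.ContainsSimplices (X := (A : SSet.{u})) (W.comap (subcomplexMap A)) := by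
  intro n σ z w p
  exact W.mem_of_eq (fun t => (subcomplexMap_charMap A σ (p t)).symm) (hW n (subVal σ) z w p)

/-- A path whose range lies in the realization of a subcomplex comes from a path there. -/
theorem mem_of_forall_mem_range (A : X.Subcomplex) (W : PathClass (SSet.toTop.obj X))
    (hA : ∀ {a b} (δ : Path a b), (W.comap (subcomplexMap A)).Mem δ)
    {x y : SSet.toTop.obj X} (γ : Path x y) (h : ∀ t, γ t ∈ Set.range (subcomplexMap A)) :
    W.Mem γ := by
  choose δ hδ using h
  have hc : Continuous δ := by
    rw [(isClosedEmbedding_subcomplexMap A).isInducing.continuous_iff]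
    convert! γ.continuous using 1
    exact funext hδ
  exact W.mem_of_eq hδ (hA (⟨⟨δ, hc⟩, rfl, rfl⟩ : Path (δ 0) (δ 1)))

/-- The collar homotopy carries the path into the lower skeleton, where `hA` applies. Its tracks are
constant or run in a single simplex, so `mem_of_homotopy` brings the conclusion back. -/
theorem mem_of_depth_lt {d : ℕ} [X.HasDimensionLT (d + 1)] {W : PathClass (SSet.toTop.obj X)}
    (hW : W.ContainsSimplices)
    (hA : ∀ {a b} (δ : Path a b), (W.comap (subcomplexMap (skel X d))).Mem δ)
    {M : C(SSet.toTop.obj X, ℝ)} (hM : ∀ (c : X.nonDegenerate d) z, M (charMap X c.1 z) = minCoord z)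
    {x y : SSet.toTop.obj X} (γ : Path x y) (h : ∀ t, M (γ t) < collar d) : W.Mem γ := by
  obtain ⟨g, K, hK1, hK2⟩ := exists_collar_homotopy X d
  refine W.mem_of_homotopy K (fun y => ?_) γ (mem_of_forall_mem_range _ W hA _ fun t => ?_)
  · rcases exists_skel_or_cell (d := d) y with ⟨a, rfl⟩ | ⟨c, z, rfl⟩
    · exact W.mem_of_eq (fun t => (hK1 a t).symm) (W.refl (subcomplexMap (skel X d) a))
    · refine W.mem_of_eq (fun t => (hK2 c z t).symm) (hW d c.1 _ _
        (⟨⟨pushPath z, continuous_pushPath.comp (Continuous.prodMk_right z)⟩, rfl, rfl⟩ :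
          Path (pushPath z 0) (pushPath z 1)))
  · change g (γ t) ∈ _
    have ht := h t
    rw [← K.apply_one (γ t)]
    rcases exists_skel_or_cell (d := d) (γ t) with ⟨a, ha⟩ | ⟨c, z, hz⟩
    · rw [← ha, hK1]
      exact ⟨a, rfl⟩
    · rw [← hz, hM] at ht
      rw [← hz, hK2, pushPath_one]
      obtain ⟨j, hj⟩ := exists_push_eq_zero ht
      exact charMap_mem_range_of_eq_zero c.1 hj

theorem sum_minCoord_smul {d : ℕ} (z : stdSimplex ℝ (Fin (d + 1))) :
    ∑ i, (minCoord z • z.1) i = minCoord z := by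
  have h : ∑ i, z.1 i = 1 := z.2.2
  simp only [Pi.smul_apply, smul_eq_mul]
  rw [← Finset.mul_sum, h, mul_one]

theorem eq_of_minCoord_smul_eq {d : ℕ} {z w : stdSimplex ℝ (Fin (d + 1))} (h0 : 0 < minCoord w)
    (h : minCoord z • z.1 = minCoord w • w.1) : z = w := by
  have h1 := sum_minCoord_smul z
  rw [h, sum_minCoord_smul] at h1
  rw [← h1] at h
  exact Subtype.ext (smul_right_injective _ h0.ne' h)

/-- A path in an open cell lifts to the simplex: normalizing the functions `κ` shows that the
pointwise preimages `z t` depend continuously on `t`. -/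
theorem mem_of_cell {d : ℕ} [X.HasDimensionLT (d + 1)] {W : PathClass (SSet.toTop.obj X)}
    (hW : W.ContainsSimplices) (c : X.nonDegenerate d) {κ : C(SSet.toTop.obj X, Fin (d + 1) → ℝ)}
    (h1 : ∀ a, κ (subcomplexMap (skel X d) a) = 0)
    (h2 : ∀ z, κ (charMap X c.1 z) = minCoord z • z.1)
    (h3 : ∀ (c' : X.nonDegenerate d) z, c' ≠ c → κ (charMap X c'.1 z) = 0)
    {x y : SSet.toTop.obj X} (γ : Path x y) (h : ∀ t, 0 < ∑ i, κ (γ t) i) : W.Mem γ := by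
  have key : ∀ t, ∃ z, charMap X c.1 z = γ t ∧ (∑ i, κ (γ t) i)⁻¹ • κ (γ t) = z.1 := by
    intro t
    have ht := h t
    rcases exists_skel_or_cell (d := d) (γ t) with ⟨a, ha⟩ | ⟨c', z, hz⟩
    · rw [← ha, h1] at ht
      simp at ht
    · by_cases hc : c' = c
      · subst hc
        refine ⟨z, hz, ?_⟩
        rw [← hz, h2, sum_minCoord_smul] at ht ⊢
        rw [smul_smul, inv_mul_cancel₀ ht.ne', one_smul]
      · rw [← hz, h3 c' z hc] at ht
        simp at ht
  choose z hz hz' using key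
  have hc : Continuous z := by
    rw [continuous_induced_rng]
    have : (Subtype.val ∘ z) = fun t => (∑ i, κ (γ t) i)⁻¹ • κ (γ t) :=
      funext fun t => (hz' t).symm
    rw [this]
    have h4 : Continuous fun t => κ (γ t) := κ.continuous.comp γ.continuous
    exact ((continuous_finsetSum _ fun i _ => (continuous_apply i).comp h4).inv₀
      fun t => (h t).ne').smul h4
  exact W.mem_of_eq hz (hW d c.1 _ _ (⟨⟨z, hc⟩, rfl, rfl⟩ : Path (z 0) (z 1)))

/-- Induction on the dimension bound. A point of small depth has the collar region as a
neighbourhood, any other point an open top cell; `mem_of_locally` glues the two cases. -/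
theorem mem_of_hasDimensionLT (d : ℕ) : ∀ (X : SSet.{u}) [X.HasDimensionLT d]
    (W : PathClass (SSet.toTop.obj X)), W.ContainsSimplices →
    ∀ {x y : SSet.toTop.obj X} (γ : Path x y), W.Mem γ := by
  induction d with
  | zero =>
    intro X _ W hW x y γ
    obtain ⟨n, σ, -⟩ := exists_charMap_eq x
    obtain ⟨k, -, -, c, -⟩ := X.exists_nonDegenerate σ
    have h1 := SSet.HasDimensionLT.degenerate_eq_top (X := X) (d := 0) k (Nat.zero_le k)
    have h2 := c.2
    rw [SSet.mem_nonDegenerate_iff_notMem_degenerate, h1] at h2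
    exact absurd trivial h2
  | succ d ih =>
    intro X _ W hW x y γ
    have hA : ∀ {a b} (δ : Path a b), (W.comap (subcomplexMap (skel X d))).Mem δ :=
      fun δ => ih _ _ (hW.comap _) δ
    obtain ⟨M, hM1, hM2⟩ := exists_depth X d
    refine W.mem_of_locally (fun x => ?_) γ
    by_cases hx : M x < collar d
    · exact ⟨{y | M y < collar d}, (isOpen_lt M.continuous continuous_const).mem_nhds hx,
        fun a b γ h => mem_of_depth_lt hW hA hM2 γ h⟩
    · rcases exists_skel_or_cell (d := d) x with ⟨a, rfl⟩ | ⟨c, z, rfl⟩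
      · rw [hM1] at hx
        exact absurd collar_pos hx
      · obtain ⟨κ, h1, h2, h3⟩ := exists_cellCoord c
        refine ⟨{y | 0 < ∑ i, κ y i}, (isOpen_lt continuous_const (continuous_finsetSum _
          fun i _ => (continuous_apply i).comp κ.continuous)).mem_nhds ?_,
          fun a b γ h => mem_of_cell hW c h1 h2 h3 γ h⟩
        change 0 < ∑ i, κ (charMap X c.1 z) i
        rw [h2, sum_minCoord_smul]
        rw [hM2] at hx
        linarith [collar_pos (d := d)]

/-- A point of an open cell is a level set of the cell coordinates; every other point lies in the
lower skeleton, which is closed. -/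
theorem isClosed_singleton_of_hasDimensionLT (d : ℕ) : ∀ (X : SSet.{u}) [X.HasDimensionLT d]
    (x : SSet.toTop.obj X), IsClosed ({x} : Set (SSet.toTop.obj X)) := by
  induction d with
  | zero =>
    intro X _ x
    obtain ⟨n, σ, -⟩ := exists_charMap_eq x
    obtain ⟨k, -, -, c, -⟩ := X.exists_nonDegenerate σ
    have h1 := SSet.HasDimensionLT.degenerate_eq_top (X := X) (d := 0) k (Nat.zero_le k)
    have h2 := c.2
    rw [SSet.mem_nonDegenerate_iff_notMem_degenerate, h1] at h2
    exact absurd trivial h2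
  | succ d ih =>
    intro X _ x
    have hs : ∀ a, IsClosed {subcomplexMap (skel X d) a} := fun a => by
      simpa using (isClosedEmbedding_subcomplexMap (skel X d)).isClosedMap _ (ih _ a)
    rcases exists_skel_or_cell (d := d) x with ⟨a, rfl⟩ | ⟨c, z, rfl⟩
    · exact hs a
    · rcases (minCoord_nonneg z).eq_or_lt with h0 | h0
      · obtain ⟨j, hj⟩ := exists_eq_minCoord z
        obtain ⟨a, ha⟩ := charMap_mem_range_of_eq_zero c.1 (hj.trans h0.symm)
        rw [← ha]
        exact hs a
      · obtain ⟨κ, h1, h2, h3⟩ := exists_cellCoord c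
        have : {charMap X c.1 z} = κ ⁻¹' {minCoord z • z.1} := by
          ext y
          simp only [Set.mem_singleton_iff, Set.mem_preimage]
          constructor
          · rintro rfl
            exact h2 z
          · intro hy
            have hne : κ y ≠ 0 := by
              intro h
              have := sum_minCoord_smul z
              rw [← hy, h] at this
              simp at this
              linarith
            rcases exists_skel_or_cell (d := d) y with ⟨a, rfl⟩ | ⟨c', w, rfl⟩
            · exact absurd (h1 a) hne
            · by_cases hc : c' = c
              · subst hc
                rw [h2] at hy
                rw [eq_of_minCoord_smul_eq h0 hy]
              · exact absurd (h3 c' w hc) hne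
        rw [this]
        exact isClosed_singleton.preimage κ.continuous

theorem charMap_mem_range_skel {n d : ℕ} (σ : Splx X n) (h : n < d)
    (z : stdSimplex ℝ (Fin (n + 1))) : charMap X σ z ∈ Set.range (subcomplexMap (skel X d)) :=
  ⟨_, subcomplexMap_charMap_subMk _ σ (X.mem_skeleton σ h) z⟩

theorem isClosed_singleton_toTop (x : SSet.toTop.obj X) :
    IsClosed ({x} : Set (SSet.toTop.obj X)) := by
  obtain ⟨n, σ, z, rfl⟩ := exists_charMap_eq x
  obtain ⟨a, ha⟩ := charMap_mem_range_skel σ (Nat.lt_succ_self n) z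
  rw [← ha]
  simpa using (isClosedEmbedding_subcomplexMap (skel X (n + 1))).isClosedMap _
    (isClosed_singleton_of_hasDimensionLT (n + 1) _ a)

theorem range_subcomplexMap_skel_mono {m n : ℕ} (h : m ≤ n) :
    Set.range (subcomplexMap (skel X m)) ⊆ Set.range (subcomplexMap (skel X n)) := by
  rintro _ ⟨a, rfl⟩
  obtain ⟨k, τ, z, rfl⟩ := exists_charMap_eq a
  rw [subcomplexMap_charMap]
  exact ⟨_, subcomplexMap_charMap_subMk _ (subVal τ) (X.skeleton.monotone h _ (subVal_mem _ τ)) z⟩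

/-- A compact subset of `|X|`, given as the image of a compact space, lies in a skeleton. -/
theorem exists_forall_mem_range_skel {K : Type*} [TopologicalSpace K] [CompactSpace K]
    {γ : K → SSet.toTop.obj X} (hγ : Continuous γ) :
    ∃ n, ∀ t, γ t ∈ Set.range (subcomplexMap (skel X n)) := by
  by_contra! hcon
  choose t ht using hcon
  -- An `m`-simplex lies in the `l`-th skeleton for every `l > m`, so it meets only finitely many of
  -- the points `γ (t l)`; thus every tail is closed.
  have hcl : ∀ k, IsClosed (γ '' (t '' Set.Ici k)) := by
    intro k
    refine isClosed_of_charMap fun m σ => ?_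
    have : charMap X σ ⁻¹' (γ '' (t '' Set.Ici k)) =
        ⋃ l ∈ Set.Icc k m, charMap X σ ⁻¹' {γ (t l)} := by
      ext z
      simp only [Set.mem_preimage, Set.mem_image, Set.mem_iUnion, Set.mem_singleton_iff,
        exists_exists_and_eq_and, Set.mem_Ici, Set.mem_Icc, exists_prop]
      constructor
      · rintro ⟨l, hl, hlz⟩
        refine ⟨l, ⟨hl, ?_⟩, hlz.symm⟩
        by_contra! hml
        exact ht l (hlz ▸ charMap_mem_range_skel σ hml z)
      · rintro ⟨l, ⟨hl, -⟩, h⟩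
        exact ⟨l, hl, h.symm⟩
    rw [this]
    exact (Set.finite_Icc k m).isClosed_biUnion fun l _ =>
      (isClosed_singleton_toTop _).preimage (charMap X σ).continuous
  -- By compactness some `γ s` lies in all tails. It also lies in a single `m`-simplex, and the tail
  -- from `m + 1` on avoids that simplex.
  obtain ⟨s, hs⟩ := IsCompact.nonempty_iInter_of_directed_nonempty_isCompact_isClosed
    (fun k => γ ⁻¹' (γ '' (t '' Set.Ici k)))
    (directed_of_isDirected_le fun a b hab => Set.preimage_mono
      (Set.image_mono (Set.image_mono (Set.Ici_subset_Ici.2 hab))))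
    (fun k => ⟨t k, t k, ⟨k, Set.self_mem_Ici, rfl⟩, rfl⟩)
    (fun k => ((hcl k).preimage hγ).isCompact) (fun k => (hcl k).preimage hγ)
  obtain ⟨m, σ, z, hz⟩ := exists_charMap_eq (γ s)
  obtain ⟨_, ⟨l, hl, rfl⟩, hls⟩ := Set.mem_iInter.1 hs (m + 1)
  refine ht l (range_subcomplexMap_skel_mono hl ?_)
  rw [hls, ← hz]
  exact charMap_mem_range_skel σ (Nat.lt_succ_self m) z

/-- Every path in `|X|` is, up to homotopy, a product of paths in simplices: a class of paths that
contains all paths in simplices contains all paths. -/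
theorem PathClass.ContainsSimplices.mem {W : PathClass (SSet.toTop.obj X)}
    (hW : W.ContainsSimplices) {x y : SSet.toTop.obj X} (γ : Path x y) : W.Mem γ := by
  obtain ⟨n, hn⟩ := exists_forall_mem_range_skel γ.continuous
  exact mem_of_forall_mem_range (skel X n) W
    (fun δ => mem_of_hasDimensionLT n _ _ (hW.comap _) δ) γ hn

end Generation

/-! ### The edge loops generate the fundamental group. -/

section CosetSection

variable {X : SSet.{u}}

/-- The class of a path as a morphism of the fundamental groupoid. -/
def pathHom {Y : Type*} [TopologicalSpace Y] {x y : Y} (p : Path x y) :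
    FundamentalGroupoid.mk x ⟶ FundamentalGroupoid.mk y :=
  Path.Homotopic.Quotient.mk p

theorem pathHom_trans {Y : Type*} [TopologicalSpace Y] {x y z : Y} (p : Path x y) (q : Path y z) :
    pathHom (p.trans q) = pathHom p ≫ pathHom q := rfl

theorem pathHom_refl {Y : Type*} [TopologicalSpace Y] (x : Y) :
    pathHom (Path.refl x) = 𝟙 _ := rfl

theorem pathHom_symm {Y : Type*} [TopologicalSpace Y] {x y : Y} (p : Path x y) :
    pathHom p.symm = Groupoid.inv (pathHom p) := rfl

theorem pathHom_eq {Y : Type*} [TopologicalSpace Y] {x y : Y} {p q : Path x y}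
    (h : p.Homotopic q) : pathHom p = pathHom q :=
  Path.Homotopic.Quotient.eq.2 h

variable (X) in
/-- Homotopy classes of paths in `|X|` that start at the vertex `v`. -/
structure PathsFrom (v : Splx X 0) : Type u where
  /-- The end point. -/
  tgt : SSet.toTop.obj X
  /-- The homotopy class. -/
  hom : FundamentalGroupoid.mk (pt X v) ⟶ FundamentalGroupoid.mk tgt

variable (v : Splx X 0)

noncomputable instance : MulAction (Pi1 X v) (PathsFrom X v) where
  smul γ e := ⟨e.tgt,
    (γ.unop : FundamentalGroupoid.mk (pt X v) ⟶ FundamentalGroupoid.mk (pt X v)) ≫ e.hom⟩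
  one_smul e := congrArg (PathsFrom.mk e.tgt) (Category.id_comp e.hom)
  mul_smul _ _ e := congrArg (PathsFrom.mk e.tgt) (Category.assoc _ _ e.hom)

/-- End points such as `charMap X (X.map f.op σ) z` and `charMap X σ (stdSimplex.map f z)` are equal
only propositionally; bundling the end point with the class allows them to be compared. -/
theorem pathsFrom_congr {x y x' y' : SSet.toTop.obj X} (p : Path x y) (p' : Path x' y')
    (h : ∀ t, p t = p' t) {f : FundamentalGroupoid.mk (pt X v) ⟶ FundamentalGroupoid.mk x}
    {f' : FundamentalGroupoid.mk (pt X v) ⟶ FundamentalGroupoid.mk x'}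
    (hf : (⟨x, f⟩ : PathsFrom X v) = ⟨x', f'⟩) :
    (⟨y, f ≫ pathHom p⟩ : PathsFrom X v) = ⟨y', f' ≫ pathHom p'⟩ := by
  obtain rfl : y = y' := by simpa using h 1
  obtain ⟨rfl, h'⟩ := PathsFrom.mk.inj hf
  obtain rfl := eq_of_heq h'
  obtain rfl : p = p' := Path.ext (funext h)
  rfl

variable (G : Subgroup (Pi1 X v))

/-- The class of a path from `v` modulo a subgroup of the fundamental group. -/
noncomputable def pathClass {x : SSet.toTop.obj X}
    (f : FundamentalGroupoid.mk (pt X v) ⟶ FundamentalGroupoid.mk x) :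
    MulAction.orbitRel.Quotient G (PathsFrom X v) :=
  Quotient.mk _ ⟨x, f⟩

theorem pathClass_eq_iff {x : SSet.toTop.obj X}
    (f f' : FundamentalGroupoid.mk (pt X v) ⟶ FundamentalGroupoid.mk x) :
    pathClass v G f = pathClass v G f' ↔ ∃ γ ∈ G,
      (γ.unop : FundamentalGroupoid.mk (pt X v) ⟶ FundamentalGroupoid.mk (pt X v)) ≫ f' = f := by
  constructor
  · intro h
    obtain ⟨⟨γ, hγ⟩, h⟩ := Quotient.exact h
    exact ⟨γ, hγ, eq_of_heq (PathsFrom.mk.inj h).2⟩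
  · rintro ⟨γ, hγ, rfl⟩
    exact Quotient.sound ⟨⟨γ, hγ⟩, rfl⟩

theorem pathClass_comp_eq_iff {x y : SSet.toTop.obj X}
    (f f' : FundamentalGroupoid.mk (pt X v) ⟶ FundamentalGroupoid.mk x)
    (p : FundamentalGroupoid.mk x ⟶ FundamentalGroupoid.mk y) :
    pathClass v G (f ≫ p) = pathClass v G (f' ≫ p) ↔ pathClass v G f = pathClass v G f' := by
  rw [pathClass_eq_iff, pathClass_eq_iff]
  simp_rw [← Category.assoc, cancel_mono]

/-- The paths that carry a given section of the path classes modulo `G` to itself. -/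
noncomputable def sectionPathClass
    (s : SSet.toTop.obj X → MulAction.orbitRel.Quotient G (PathsFrom X v)) :
    PathClass (SSet.toTop.obj X) where
  Mem {x y} γ := ∀ f : FundamentalGroupoid.mk (pt X v) ⟶ FundamentalGroupoid.mk x,
    pathClass v G f = s x ↔ pathClass v G (f ≫ pathHom γ) = s y
  of_homotopic h h' f := by rw [← pathHom_eq h]; exact h' f
  refl x f := by rw [pathHom_refl, Category.comp_id]
  symm {x y γ} h f := by
    rw [h, pathHom_symm, Category.assoc, Groupoid.inv_comp, Category.comp_id]
  trans h h' f := by rw [pathHom_trans, ← Category.assoc, h, h']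

variable {T : Set (Splx X 1)} (hT : IsMaximalTree X T)

/-- A path in a simplex from its first vertex to a given point. -/
noncomputable def fromFirstVertex {n : ℕ} (z : stdSimplex ℝ (Fin (n + 1))) :
    Path (stdSimplex.vertex (S := ℝ) (0 : Fin (n + 1))) z :=
  have := pathConnectedSpace_stdSimplex n
  PathConnectedSpace.somePath _ _

/-- The first vertex of a simplex. -/
def firstVertex {n : ℕ} (σ : Splx X n) : Splx X 0 :=
  X.map (SimplexCategory.const (.mk 0) (.mk n) 0).op σ

theorem charMap_firstVertex {n : ℕ} (σ : Splx X n) :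
    pt X (firstVertex σ) = charMap X σ (stdSimplex.vertex 0) :=
  (charMap_vertex X σ 0).symm

/-- The path that runs in the maximal tree from `v` to the first vertex of a simplex, and then
in the simplex to a given point. -/
noncomputable def treePath {n : ℕ} (σ : Splx X n) (z : stdSimplex ℝ (Fin (n + 1))) :
    FundamentalGroupoid.mk (pt X v) ⟶ FundamentalGroupoid.mk (charMap X σ z) :=
  Groupoid.inv (hT.walk (firstVertex σ) v).hom ≫
    pathHom (((fromFirstVertex z).map (charMap X σ).continuous).cast
      (charMap_firstVertex σ) rfl)

theorem treePath_comp {n : ℕ} (σ : Splx X n) {z w : stdSimplex ℝ (Fin (n + 1))} (p : Path z w) :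
    treePath v hT σ z ≫ pathHom (p.map (charMap X σ).continuous) = treePath v hT σ w := by
  have := simplyConnectedSpace_stdSimplex n
  unfold treePath
  rw [Category.assoc, ← pathHom_trans]
  congr 1
  apply pathHom_eq
  have h := (SimplyConnectedSpace.paths_homotopic ((fromFirstVertex z).trans p)
    (fromFirstVertex w)).map (charMap X σ)
  have h' := h.pathCast (charMap_firstVertex σ) rfl
  convert! h' using 1
  rw [Path.map_trans]
  rfl

theorem inv_walk_comp_edgeHom {a b : Splx X 0} (e : X.Edge a b) :
    Groupoid.inv (hT.walk a v).hom ≫ edgeHom e =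
      ((edgeLoop hT v e).unop : FundamentalGroupoid.mk (pt X v) ⟶ FundamentalGroupoid.mk (pt X v)) ≫
        Groupoid.inv (hT.walk b v).hom := by
  change _ = (Groupoid.inv (hT.walk a v).hom ≫ edgeHom e ≫ (hT.walk b v).hom) ≫ _
  rw [Category.assoc, Category.assoc, Groupoid.comp_inv, Category.comp_id]

/-- The edge of a simplex from its first vertex to its vertex `f 0`. -/
def firstEdge {m n : ℕ} (f : SimplexCategory.mk m ⟶ SimplexCategory.mk n) (σ : Splx X n) :
    X.Edge (firstVertex σ) (firstVertex (X.map f.op σ)) where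
  edge := X.map (SimplexCategory.mkOfLe 0 (f.toOrderHom 0) (Fin.zero_le _)).op σ
  src_eq := by
    change X.map (SimplexCategory.δ (n := 0) 1).op (X.map _ _) = X.map _ _
    rw [← CategoryTheory.comp_apply, ← X.map_comp, ← op_comp]
    congr 4
    exact SimplexCategory.Hom.ext_zero_left _ _ rfl
  tgt_eq := by
    change X.map (SimplexCategory.δ (n := 0) 0).op (X.map _ _) = X.map _ (X.map _ _)
    rw [← CategoryTheory.comp_apply, ← CategoryTheory.comp_apply, ← X.map_comp,
      ← X.map_comp, ← op_comp, ← op_comp]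
    congr 4
    exact SimplexCategory.Hom.ext_zero_left _ _ rfl

theorem edgePath_firstEdge {m n : ℕ} (f : SimplexCategory.mk m ⟶ SimplexCategory.mk n)
    (σ : Splx X n) (t) : edgePath (firstEdge f σ) t =
      charMap X σ (seg 0 (f.toOrderHom 0) (Fin.zero_le _) t) := by
  change charMap X (X.map _ σ) _ = _
  rw [charMap_map]
  rfl

/-- Inside the simply connected simplex, a path from the first vertex may be rerouted along the edge
to the vertex `f 0`. Replacing that edge and the tree path before it by the tree path to `f 0` costs
exactly one generator. -/
theorem treePath_map {m n : ℕ} (f : SimplexCategory.mk m ⟶ SimplexCategory.mk n)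
    (σ : Splx X n) (z : stdSimplex ℝ (Fin (m + 1))) :
    (⟨_, treePath v hT σ (stdSimplex.map f z)⟩ : PathsFrom X v) =
      edgeLoop hT v (firstEdge f σ) • ⟨_, treePath v hT (X.map f.op σ) z⟩ := by
  set q : Path (stdSimplex.vertex (S := ℝ) (f.toOrderHom 0)) (stdSimplex.map f z) :=
    ((fromFirstVertex z).map (stdSimplex.continuous_map f)).cast
      (stdSimplex.map_vertex _ _).symm rfl
  have h1 : treePath v hT σ (stdSimplex.map f z) =
      treePath v hT σ (stdSimplex.vertex (f.toOrderHom 0)) ≫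
        pathHom (q.map (charMap X σ).continuous) := (treePath_comp v hT σ q).symm
  have h2 : (⟨_, treePath v hT σ (stdSimplex.vertex (f.toOrderHom 0))⟩ : PathsFrom X v) =
      ⟨_, ((edgeLoop hT v (firstEdge f σ)).unop :
        FundamentalGroupoid.mk (pt X v) ⟶ FundamentalGroupoid.mk (pt X v)) ≫
        Groupoid.inv (hT.walk (firstVertex (X.map f.op σ)) v).hom⟩ := by
    rw [← inv_walk_comp_edgeHom]
    have := simplyConnectedSpace_stdSimplex n
    have h3 : pathHom (((fromFirstVertex (stdSimplex.vertex (f.toOrderHom 0))).map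
        (charMap X σ).continuous).cast (charMap_firstVertex σ) rfl) =
        pathHom (((seg 0 (f.toOrderHom 0) (Fin.zero_le _)).map
        (charMap X σ).continuous).cast (charMap_firstVertex σ) rfl) :=
      pathHom_eq (((SimplyConnectedSpace.paths_homotopic _ _).map (charMap X σ)).pathCast _ _)
    unfold treePath
    rw [h3]
    exact pathsFrom_congr v _ (edgePath (firstEdge f σ))
      (fun t => (edgePath_firstEdge f σ t).symm) rfl
  rw [h1]
  refine (pathsFrom_congr v _ (((fromFirstVertex z).map
    (charMap X (X.map f.op σ)).continuous).cast (charMap_firstVertex _) rfl)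
    (fun t => ?_) h2).trans ?_
  · exact (charMap_map X f σ (fromFirstVertex z t)).symm
  · rw [Category.assoc]
    rfl

/-- The fundamental group of `|X|` is generated by the loops `g_e`. -/
theorem eq_top_of_edgeLoop_mem (hG : ∀ {a b : Splx X 0} (e : X.Edge a b), edgeLoop hT v e ∈ G) :
    G = ⊤ := by
  obtain ⟨s, hs⟩ := exists_function_charMap (X := X)
    (fun n σ z => pathClass v G (treePath v hT σ z)) (fun m n f σ z => by
      refine Quotient.sound ⟨⟨(edgeLoop hT v (firstEdge f σ))⁻¹, G.inv_mem (hG _)⟩, ?_⟩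
      exact inv_smul_eq_iff.2 (treePath_map v hT f σ z))
  -- Both ends of a path in one simplex can be represented by that simplex, and there the tree paths
  -- are compatible by `treePath_comp`.
  have hW : (sectionPathClass v G s).ContainsSimplices := by
    intro n σ z w p f
    rw [hs, hs, ← treePath_comp v hT σ p, pathClass_comp_eq_iff]
  rw [eq_top_iff]
  rintro γ -
  obtain ⟨f, hf⟩ : ∃ f : FundamentalGroupoid.mk (pt X v) ⟶ FundamentalGroupoid.mk (pt X v),
      pathClass v G f = s (pt X v) := ⟨treePath v hT v (stdSimplex.vertex 0), (hs 0 v _).symm⟩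
  -- Conjugating by `f` is chosen so that transport of `f` along `p` gives `γ ≫ f`. Preservation of
  -- the section then says that `γ ≫ f` and `f` agree modulo `G`.
  obtain ⟨p, hp⟩ := Quotient.exists_rep (Groupoid.inv f ≫
    (γ.unop : FundamentalGroupoid.mk (pt X v) ⟶ FundamentalGroupoid.mk (pt X v)) ≫ f)
  have h1 := (hW.mem p f).1 hf
  rw [← hf, pathClass_eq_iff] at h1
  obtain ⟨δ, hδ, h⟩ := h1
  have h2 : pathHom p = Groupoid.inv f ≫
    (γ.unop : FundamentalGroupoid.mk (pt X v) ⟶ FundamentalGroupoid.mk (pt X v)) ≫ f := hp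
  rw [h2, ← Category.assoc f, Groupoid.comp_inv, Category.id_comp, cancel_mono] at h
  have : δ = γ := MulOpposite.unop_injective h
  exact this ▸ hδ

end CosetSection

/-! ### Monodromy of the cover, and the main conclusions. -/

section Monodromy

variable {X : SSet.{u}} {T : Set (Splx X 1)} (hT : IsMaximalTree X T) (v : Splx X 0)
  {H : Type u} [Group H] (χ : Pi1 X v →* H)

theorem isCoveringMap_projTop : IsCoveringMap (projTop hT v χ) :=
  (isQuotientCoveringMap_projTop hT v χ).isCoveringMap

/-- The vertex `(h, a)` of `|X̃|` as a point of the fibre over `a`. -/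
noncomputable def fiberPt (h : H) (a : Splx X 0) : projTop hT v χ ⁻¹' {pt X a} :=
  ⟨pt (cover hT v χ) (coverMk hT v χ h a), projTop_charMap hT v χ _ _⟩

/-- The edge of `X̃` over an edge `e` of `X` that starts at the vertex `(h, ∂₁e)`. -/
noncomputable def liftEdge (h : H) {a b : Splx X 0} (e : X.Edge a b) :
    (cover hT v χ).Edge (coverMk hT v χ h a)
      (coverMk hT v χ (h * χ (edgeLoop hT v e)) b) where
  edge := coverMk hT v χ (h * χ (edgeLoop hT v e)) e.edge
  src_eq := by
    refine (cover_δ_last hT v χ 0 _ e.edge).trans (Prod.ext ?_ e.src_eq)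
    change h * χ (edgeLoop hT v e) * (tau hT v χ 1 e.edge)⁻¹ = h
    rw [tau_edge, mul_inv_cancel_right]
  tgt_eq := (cover_δ_castSucc hT v χ 0 0 _ e.edge).trans (Prod.ext rfl e.tgt_eq)

theorem monodromy_edgeHom (h : H) {a b : Splx X 0} (e : X.Edge a b) :
    (isCoveringMap_projTop hT v χ).monodromy (edgeHom e) (fiberPt hT v χ h a) =
      fiberPt hT v χ (h * χ (edgeLoop hT v e)) b := by
  refine (isCoveringMap_projTop hT v χ).monodromy_eq_of_map_eq
    (Path.Homotopic.Quotient.mk (edgePath (liftEdge hT v χ h e))) ?_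
  refine congrArg Path.Homotopic.Quotient.mk (Path.ext (funext fun t => ?_))
  exact projTop_charMap hT v χ _ _

theorem monodromy_inv {E B : Type*} [TopologicalSpace E] [TopologicalSpace B] {p : E → B}
    (cov : IsCoveringMap p) {x y : B}
    (f : FundamentalGroupoid.mk x ⟶ FundamentalGroupoid.mk y) {e : p ⁻¹' {x}} {e' : p ⁻¹' {y}}
    (h : cov.monodromy f e = e') : cov.monodromy (Groupoid.inv f) e' = e := by
  rw [← h]
  refine (cov.monodromy_trans_apply f (Groupoid.inv f) e).symm.trans ?_
  have : Path.Homotopic.Quotient.trans f (Groupoid.inv f) = Path.Homotopic.Quotient.refl x :=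
    Groupoid.comp_inv f
  rw [this, cov.monodromy_refl]
  rfl

/-- Tree edges have trivial loop class, so a walk in the tree lifts within one level `h`, in either
direction of travel. -/
theorem monodromy_walk (h : H) {a b : Splx X 0} (p : EdgeWalk X a b)
    (hp : ∀ s ∈ p.edges, s.1 ∈ T) :
    (isCoveringMap_projTop hT v χ).monodromy p.hom (fiberPt hT v χ h a) =
      fiberPt hT v χ h b := by
  induction p with
  | nil a => exact congrFun (isCoveringMap_projTop hT v χ).monodromy_refl _
  | fwd e p ih =>
    refine ((isCoveringMap_projTop hT v χ).monodromy_trans_apply (edgeHom e) p.hom _).trans ?_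
    rw [← ih fun s hs => hp s (List.mem_cons_of_mem _ hs)]
    congr 1
    refine (monodromy_edgeHom hT v χ h e).trans ?_
    rw [edgeLoop_of_mem hT v e (hp _ List.mem_cons_self), map_one, mul_one]
  | bwd e p ih =>
    refine ((isCoveringMap_projTop hT v χ).monodromy_trans_apply (Groupoid.inv (edgeHom e))
      p.hom _).trans ?_
    rw [← ih fun s hs => hp s (List.mem_cons_of_mem _ hs)]
    congr 1
    refine monodromy_inv _ _ ((monodromy_edgeHom hT v χ h e).trans ?_)
    rw [edgeLoop_of_mem hT v e (hp _ List.mem_cons_self), map_one, mul_one]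

theorem monodromy_edgeLoop {a b : Splx X 0} (e : X.Edge a b) :
    (isCoveringMap_projTop hT v χ).monodromy (edgeLoop hT v e).unop (fiberPt hT v χ 1 v) =
      fiberPt hT v χ (χ (edgeLoop hT v e)) v := by
  refine ((isCoveringMap_projTop hT v χ).monodromy_trans_apply _ _ _).trans ?_
  rw [monodromy_inv _ _ (monodromy_walk hT v χ 1 _ (hT.walk_isReducedIn a v).1)]
  refine ((isCoveringMap_projTop hT v χ).monodromy_trans_apply _ _ _).trans ?_
  have h := monodromy_edgeHom hT v χ 1 e
  rw [one_mul] at h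
  rw [show (isCoveringMap_projTop hT v χ).monodromy (edgeHom e) _ = _ from h]
  exact monodromy_walk hT v χ _ _ (hT.walk_isReducedIn b v).1

/-- The endpoint of the lift of a loop at `v` to `|X̃|` is given by `χ`. -/
theorem toMulOpposite_eq (γ : Pi1 X v) :
    (isQuotientCoveringMap_projTop hT v χ).fundamentalGroupToMulOpposite (fiberPt hT v χ 1 v)
      γ.unop = MulOpposite.op (χ γ) := by
  let φ := (isQuotientCoveringMap_projTop hT v χ).fundamentalGroupToMulOpposite
    (fiberPt hT v χ 1 v)
  let ψ : Pi1 X v →* H :=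
    { toFun γ := (φ γ.unop).unop
      map_one' := by rw [MulOpposite.unop_one, map_one, MulOpposite.unop_one]
      map_mul' γ δ := by rw [MulOpposite.unop_mul, map_mul, MulOpposite.unop_mul] }
  -- Two homomorphisms that agree on the generators `g_e` are equal.
  have h : ψ.eqLocus χ = ⊤ := by
    refine eq_top_of_edgeLoop_mem v _ hT fun e => ?_
    suffices φ (edgeLoop hT v e).unop = MulOpposite.op (χ (edgeLoop hT v e)) from
      congrArg MulOpposite.unop this
    refine (isQuotientCoveringMap_projTop hT v
      χ).fundamentalGroupToMulOpposite_apply_eq_Iff.2 ?_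
    rw [monodromy_edgeLoop]
    refine (smul_charMap hT v χ _ _ _).trans ?_
    change charMap _ (coverMk hT v χ (_ * 1) v) _ = _
    rw [mul_one]
    rfl
  have h' : γ ∈ ψ.eqLocus χ := h ▸ Subgroup.mem_top γ
  exact congrArg MulOpposite.op (show ψ γ = χ γ from h')

theorem monodromy_eq_fiberPt (γ : Pi1 X v) :
    (isCoveringMap_projTop hT v χ).monodromy γ.unop (fiberPt hT v χ 1 v) =
      fiberPt hT v χ (χ γ) v := by
  refine Subtype.ext ?_
  refine ((isQuotientCoveringMap_projTop hT v
    χ).fundamentalGroupToMulOpposite_apply_eq_Iff.1 (toMulOpposite_eq hT v χ γ)).symm.trans ?_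
  refine (smul_charMap hT v χ _ _ _).trans ?_
  change charMap _ (coverMk hT v χ (_ * 1) v) _ = _
  rw [mul_one]
  rfl

theorem range_mapOfEq_projTop :
    (FundamentalGroup.mapOfEq (projTop hT v χ) (projTop_basePt hT v χ)).range =
      ((isQuotientCoveringMap_projTop hT v χ).fundamentalGroupToMulOpposite
        (fiberPt hT v χ 1 v)).ker := by
  rw [IsQuotientCoveringMap.ker_fundamentalGroupToMulOpposite]
  exact ((isQuotientCoveringMap_projTop hT v χ).ker_monodromyPerm (fiberPt hT v χ 1 v)).symm

theorem range_mapOfEq_projTop_op :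
    (FundamentalGroup.mapOfEq (projTop hT v χ) (projTop_basePt hT v χ)).range.op = χ.ker := by
  ext γ
  rw [Subgroup.mem_op, range_mapOfEq_projTop, MonoidHom.mem_ker, toMulOpposite_eq,
    MulOpposite.op_eq_one_iff, MonoidHom.mem_ker]

theorem joined_monodromy {E B : Type*} [TopologicalSpace E] [TopologicalSpace B] {p : E → B}
    (cov : IsCoveringMap p) {x y : B} (f : Path.Homotopic.Quotient x y) (e : p ⁻¹' {x}) :
    Joined e.1 (cov.monodromy f e).1 := by
  obtain ⟨q, -⟩ := Quotient.exists_rep (cov.liftPathQuotient f e)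
  exact ⟨q⟩

/-- Lift a loop whose `χ`-value is the level of the target vertex, then a tree walk within that
level, and finish inside the simplex. -/
theorem joined_basePt (hχ : Function.Surjective χ) (x : SSet.toTop.obj (cover hT v χ)) :
    Joined (basePt hT v χ) x := by
  obtain ⟨n, p, z, rfl⟩ := exists_charMap_eq x
  have := pathConnectedSpace_stdSimplex n
  have h1 : Joined (pt (cover hT v χ) (firstVertex p)) (charMap (cover hT v χ) p z) :=
    charMap_firstVertex p ▸ ⟨(fromFirstVertex z).map (charMap (cover hT v χ) p).continuous⟩
  refine Joined.trans ?_ h1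
  obtain ⟨γ, hγ⟩ := hχ (coverFst (firstVertex p))
  have h2 := joined_monodromy (isCoveringMap_projTop hT v χ) γ.unop (fiberPt hT v χ 1 v)
  rw [monodromy_eq_fiberPt, hγ] at h2
  have h3 := joined_monodromy (isCoveringMap_projTop hT v χ)
    (hT.walk v (coverSnd (firstVertex p))).hom
    (fiberPt hT v χ (coverFst (firstVertex p)) v)
  rw [monodromy_walk hT v χ _ _ (hT.walk_isReducedIn _ _).1] at h3
  exact h2.trans h3

theorem pathConnectedSpace_cover (hχ : Function.Surjective χ) :
    PathConnectedSpace (SSet.toTop.obj (cover hT v χ)) where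
  nonempty := ⟨basePt hT v χ⟩
  joined x y := (joined_basePt hT v χ hχ x).symm.trans (joined_basePt hT v χ hχ y)

/-- Homotopies lift through a covering map; the conjugation only adjusts for the propositional
equality of base points. -/
theorem injective_mapOfEq_projTop :
    Function.Injective (FundamentalGroup.mapOfEq (projTop hT v χ) (projTop_basePt hT v χ)) :=
  (eqToIso (congrArg FundamentalGroupoid.mk (projTop_basePt hT v χ))).conj.injective.comp
    ((isCoveringMap_projTop hT v χ).injective_path_homotopic_map _ _)

/-- The fundamental group embeds with image `ker χ`, which is trivial, and path-connectedness
transports this to every base point. -/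
theorem simplyConnectedSpace_cover (hχ : Function.Bijective χ) :
    SimplyConnectedSpace (SSet.toTop.obj (cover hT v χ)) := by
  have := pathConnectedSpace_cover hT v χ hχ.2
  have h1 (γ : FundamentalGroup (SSet.toTop.obj (cover hT v χ)) (basePt hT v χ)) : γ = 1 := by
    refine injective_mapOfEq_projTop hT v χ ?_
    rw [map_one]
    have h : MulOpposite.op (FundamentalGroup.mapOfEq (projTop hT v χ) (projTop_basePt hT v χ) γ) ∈
        χ.ker := by
      rw [← range_mapOfEq_projTop_op hT]
      exact ⟨γ, rfl⟩
    rw [(MonoidHom.ker_eq_bot_iff χ).2 hχ.1] at h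
    exact congrArg MulOpposite.unop (Subgroup.mem_bot.1 h)
  refine simply_connected_iff_loops_nullhomotopic.2 ⟨this, fun x γ => ?_⟩
  let φ := FundamentalGroup.fundamentalGroupMulEquivOfPathConnected (basePt hT v χ) x
  have h2 (δ : FundamentalGroup (SSet.toTop.obj (cover hT v χ)) x) : δ = 1 := by
    rw [← φ.apply_symm_apply δ, h1 (φ.symm δ), map_one]
  exact Path.Homotopic.Quotient.eq.1 (h2 (Path.Homotopic.Quotient.mk γ))

end Monodromy

end SimplicialCover

theorem mainTheorem2 {X : SSet.{u}} (hX : X.IsConnected) (T : Set (Splx X 1))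
    (hT : IsMaximalTree X T) (v : Splx X 0) {H : Type u} [Group H]
    (χ : Pi1 X v →* H) (hχ : Function.Surjective χ) :
    (IsCoveringMap (projTop hT v χ) ∧
      Function.Surjective (projTop hT v χ) ∧
      PathConnectedSpace (SSet.toTop.obj (cover hT v χ)) ∧
      (FundamentalGroup.mapOfEq (projTop hT v χ) (projTop_basePt hT v χ)).range.Normal ∧
      (FundamentalGroup.mapOfEq (projTop hT v χ) (projTop_basePt hT v χ)).range.op = χ.ker) ∧
    (Function.Bijective χ → SimplyConnectedSpace (SSet.toTop.obj (cover hT v χ))) := by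
  refine ⟨⟨isCoveringMap_projTop hT v χ, surjective_projTop hT v χ,
    pathConnectedSpace_cover hT v χ hχ, ?_, range_mapOfEq_projTop_op hT v χ⟩,
    simplyConnectedSpace_cover hT v χ⟩
  -- Normality holds because the image is the kernel of the monodromy homomorphism.
  rw [range_mapOfEq_projTop]
  exact MonoidHom.normal_ker _
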